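/- **Conventions.** A permutation $\pi$ of size $n$ is written $\pi(1),\dots,\pi(n)$; $\pi$ contains $\sigma$ if some subsequence of $\pi$ has the same relative order as $\sigma$; $\mathrm{Av}(F)$ is the class of permutations containing no member of $F$. The elements of $\pi$ are the points $(i,\pi(i))$ (left/right refers to $i$, below/above to $\pi(i)$). The graph $G_\pi$ has vertex set $\{1,\dots,n\}$, and distinct $\pi(i),\pi(j)$ are adjacent iff $|i-j|=1$ or $|\pi(i)-\pi(j)|=1$. The reverse-complement of $\pi$ is $n+1-\pi(n),\dots,n+1-\pi(1)$. For even $r\ge 2$, the elementary wall of height $r$ is obtained from the $(r+1)\times(2r+2)$ grid (vertices $(i,j)$ with $1\le i\le r+1$, $1\le j\le 2r+2$; two vertices adjacent iff $|i-i'|+|j-j'|=1$) by removing the vertices $(1,2r+2)$ and $(r+1,1)$, the edges $\{(i,2j),(i+1,2j)\}$ with $i$ odd and the edges $\{(i,2j-1),(i+1,2j-1)\}$ with $i$ even, $1\le j\le r+1$. An $r$-wall is a subdivision of it; a graph contains an $r$-wall if it has one as a subgraph. The $k$-track $\tau_k$ is the permutation of size $k^2$ order-isomorphic to $1,2k,3,2k+2,5,2k+4,\dots,k^2-1,k^2+2k-2$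 if $k$ is even, and to $1,2k,3,2k+2,\dots,k^2-k-1,k^2+k-2,k^2-k+1,k^2-k+3,\dots,k^2+k-1$ if $k$ is odd. Its elements are partitioned into increasing blocks $A_1,\dots,A_k$ of size $k$: for $2j\le k$, the $j$th group of $2k$ consecutive positions is occupied alternately by elements of $A_{2j-1}$ and of $A_{2j}$, beginning with $A_{2j-1}$; for odd $k$ the last $k$ positions are occupied by $A_k$. The $k$-spiral is the twirl of $\tau_k$ with respect to $A_1,\dots,A_k$, i.e. the permutation with blocks $A_1^*,\dots,A_k^*$ (the element $x\in A_i$ corresponding to $x^*\in A_i^*$) determined as follows. 1. The order inside $A_i$ is, for $i\equiv 1,2,3,0 \pmod 4$ respectively: reversed vertically only; kept; reversed horizontally only; reversed both horizontally and vertically. 2. For $x\in A_i$, $y\in A_{i+1}$: if $i\equiv0\pmod 4$, $x^*$ is above $y^*$ iff $x$ is below $y$; if $i\equiv1$, $x^*$ is to the right of $y^*$ iff $x$ is to the right of $y$; if $i\equiv2$, $x^*$ is above $y^*$ iff $x$ is above $y$; if $i\equiv3$, $x^*$ is to the right of $y^*$ iff $x$ is to the left of $y$. 3. For $i\ge 2$: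 if $i\equiv0\pmod 4$, $A_i^*$ is above $A_{i-1}^*$ and all $A^*_j$ with $j>i$ are above and to the left of $A^*_{i-1}$; if $i\equiv1$, $A_i^*$ is to the left of $A_{i-1}^*$ and all $A_j^*$, $j>i$, are below and to the left of $A_{i-1}^*$; if $i\equiv2$, $A_i^*$ is below $A_{i-1}^*$ and all $A_j^*$, $j>i$, are below and to the right of $A_{i-1}^*$; if $i\equiv3$, $A_i^*$ is to the right of $A_{i-1}^*$ and all $A_j^*$, $j>i$, are above and to the right of $A_{i-1}^*$. **Theorem.** Let $\pi\in\mathrm{Av}(2143,3412,3142)$, let $k\ge 0$ be an integer and let $r\ge 2$ be an even integer with $r\ge 300k^{3/2}$. If $G_\pi$ contains an $r$-wall, then $\pi$ contains the $k$-spiral or the reverse-complement of the $k$-spiral. -/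

import Mathlib

namespace PermPattern

/-! ### Permutations, containment, classes

A permutation of size `n` is an `Equiv.Perm (Fin n)` (positions and values are counted from `0`).
The element at position `i` has value `π i`. -/

/-- `Contains τ π`: the permutation `τ` contains `π` as a pattern. -/
def Contains {n k : ℕ} (τ : Equiv.Perm (Fin n)) (π : Equiv.Perm (Fin k)) : Prop :=
  ∃ f : Fin k → Fin n, StrictMono f ∧ ∀ a b : Fin k, τ (f a) < τ (f b) ↔ π a < π b

/-- The permutations of size `n` in the class `Av(F)`. -/
def Av (F : Set (Σ m : ℕ, Equiv.Perm (Fin m))) (n : ℕ) : Set (Equiv.Perm (Fin n)) :=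
  {π | ∀ σ ∈ F, ¬ Contains π σ.2}

/-- The permutation `2143`. -/
def p2143 : Equiv.Perm (Fin 4) := ⟨![1, 0, 3, 2], ![1, 0, 3, 2], by decide, by decide⟩

/-- The permutation `3412`. -/
def p3412 : Equiv.Perm (Fin 4) := ⟨![2, 3, 0, 1], ![2, 3, 0, 1], by decide, by decide⟩

/-- The permutation `3142`. -/
def p3142 : Equiv.Perm (Fin 4) := ⟨![2, 0, 3, 1], ![1, 3, 0, 2], by decide, by decide⟩

/-- The reverse-complement (rotation of the diagram by 180 degrees). -/
def revComp {n : ℕ} (π : Equiv.Perm (Fin n)) : Equiv.Perm (Fin n) :=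
  (Fin.revPerm.trans π).trans Fin.revPerm

/-- The permutation whose diagram is order-isomorphic to the set of points `(x e, y e)`,
`e : Fin n` (for injective `x` and `y`): `Tuple.sort x` sends a position to the point at this
position, and the inverse of `Tuple.sort y` sends a point to its vertical rank. -/
def ofPoints {n : ℕ} {α : Type*} [LinearOrder α] (x y : Fin n → α) : Equiv.Perm (Fin n) :=
  (Tuple.sort x).trans (Tuple.sort y).symm

/-- The reduction of a sequence of distinct numbers: the `i`th smallest is replaced by `i`. -/
def reduction {n : ℕ} {α : Type*} [LinearOrder α] (ω : Fin n → α) : Equiv.Perm (Fin n) :=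
  (Tuple.sort ω).symm

/-! ### The graph of a permutation -/

/-- The graph `G_π`. Its vertices are the values of `π`; two values are adjacent if they are
consecutive (red edge) or if their positions are consecutive (blue edge). -/
def permGraph {n : ℕ} (π : Equiv.Perm (Fin n)) : SimpleGraph (Fin n) where
  Adj a b := Nat.dist (π.symm a) (π.symm b) = 1 ∨ Nat.dist (a : ℕ) (b : ℕ) = 1
  symm := ⟨fun a b h => by simpa only [Nat.dist_comm] using h⟩
  loopless := ⟨fun a h => by simp [Nat.dist_self] at h⟩

/-! ### Walls -/

/-- The vertices of the elementary wall of height `r`: those of the `(r+1) × (2r+2)` grid without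
the two opposite corners `(1, 2r+2)` and `(r+1, 1)`. -/
def WallVertex (r : ℕ) : Type :=
  {p : ℕ × ℕ // (1 ≤ p.1 ∧ p.1 ≤ r + 1) ∧ (1 ≤ p.2 ∧ p.2 ≤ 2 * r + 2) ∧
    p ≠ (1, 2 * r + 2) ∧ p ≠ (r + 1, 1)}

/-- The grid edges `{(i, j), (i+1, j)}` that are deleted: `i` odd and `j` even, or `i` even and
`j` odd. -/
def WallRemoved (p q : ℕ × ℕ) : Prop :=
  q.1 = p.1 + 1 ∧ q.2 = p.2 ∧ ((Odd p.1 ∧ Even p.2) ∨ (Even p.1 ∧ Odd p.2))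

/-- The elementary wall of height `r` (used for even `r ≥ 2`). -/
def elementaryWall (r : ℕ) : SimpleGraph (WallVertex r) where
  Adj p q := Nat.dist p.1.1 q.1.1 + Nat.dist p.1.2 q.1.2 = 1 ∧
    ¬ WallRemoved p.1 q.1 ∧ ¬ WallRemoved q.1 p.1
  symm := ⟨fun p q h => ⟨by simpa only [Nat.dist_comm] using h.1, h.2.2, h.2.1⟩⟩
  loopless := ⟨fun p h => by simp [Nat.dist_self] at h⟩

/-- `G` contains a subdivision of `H` as a subgraph: the vertices of `H` are sent to distinct
branch vertices of `G`, and the edges of `H` to paths of `G` between the corresponding branch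
vertices; a path meets no branch vertices other than its two ends, and two paths meet only in
common ends. -/
def ContainsSubdivision {V W : Type*} (G : SimpleGraph V) (H : SimpleGraph W) : Prop :=
  ∃ (φ : W → V) (P : ∀ u v : W, H.Adj u v → G.Walk (φ u) (φ v)),
    Function.Injective φ ∧
    (∀ u v (h : H.Adj u v), (P u v h).IsPath) ∧
    (∀ u v (h : H.Adj u v), P v u h.symm = (P u v h).reverse) ∧
    (∀ u v (h : H.Adj u v) w, φ w ∈ (P u v h).support → w = u ∨ w = v) ∧
    (∀ u v (h : H.Adj u v) u' v' (h' : H.Adj u' v'), s(u, v) ≠ s(u', v') →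
      ∀ x, x ∈ (P u v h).support → x ∈ (P u' v' h').support →
        ∃ w, x = φ w ∧ (w = u ∨ w = v) ∧ (w = u' ∨ w = v'))

/-- `G` contains an `r`-wall, that is, a subdivision of the elementary wall of height `r`. -/
def ContainsWall {V : Type*} (G : SimpleGraph V) (r : ℕ) : Prop :=
  ContainsSubdivision G (elementaryWall r)

/-! ### Decompositions and the twirl

A partition of the elements of `π` into blocks `B_1, …, B_m` is given by a map `β` that sends
each position `i` to the index (from `1` to `m`) of the block of the element at position `i`. -/

/-- Stair-decompositions. -/
structure IsStairDecomp {n : ℕ} (π : Equiv.Perm (Fin n)) (m : ℕ) (β : Fin n → ℕ) : Prop where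
  range : ∀ i, 1 ≤ β i ∧ β i ≤ m
  increasing : ∀ i j, β i = β j → i < j → π i < π j
  above : ∀ i j, Odd (β i) → β j = β i + 1 → π i < π j
  right : ∀ i j, Even (β i) → β j = β i + 1 → i < j
  above_right : ∀ i j, β j = β i + 2 → i < j ∧ π i < π j

/-- Spiral decompositions. -/
structure IsSpiralDecomp {n : ℕ} (π : Equiv.Perm (Fin n)) (m : ℕ) (β : Fin n → ℕ) : Prop where
  range : ∀ i, 1 ≤ β i ∧ β i ≤ m
  odd_decreasing : ∀ i j, β i = β j → Odd (β i) → i < j → π j < π i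
  even_increasing : ∀ i j, β i = β j → Even (β i) → i < j → π i < π j
  next_above : ∀ i j, β j = β i + 1 → β j % 4 = 0 → π i < π j
  rest_above_left : ∀ i j, β i + 1 < β j → (β i + 1) % 4 = 0 → π i < π j ∧ j < i
  next_left : ∀ i j, β j = β i + 1 → β j % 4 = 1 → j < i
  rest_below_left : ∀ i j, β i + 1 < β j → (β i + 1) % 4 = 1 → π j < π i ∧ j < i
  next_below : ∀ i j, β j = β i + 1 → β j % 4 = 2 → π j < π i
  rest_below_right : ∀ i j, β i + 1 < β j → (β i + 1) % 4 = 2 → π j < π i ∧ i < j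
  next_right : ∀ i j, β j = β i + 1 → β j % 4 = 3 → i < j
  rest_above_right : ∀ i j, β i + 1 < β j → (β i + 1) % 4 = 3 → π i < π j ∧ i < j

/-- `π'` with the decomposition `β'` is the twirl of `π` with respect to the decomposition `β`
into `m` blocks; `e` sends the position of an element `x` of `π` to the position of the
corresponding element `x*` of `π'`. The center of the spiral lies to the right of and below the
blocks `B_i` with `i % 4 = 1`, to the right of and above those with `i % 4 = 2`, to the left of
and above those with `i % 4 = 3`, to the left of and below those with `i % 4 = 0`. The top-right
corner of each block has to be turned towards the center by flips of rows and columns. -/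
structure IsTwirl {n : ℕ} (π : Equiv.Perm (Fin n)) (m : ℕ) (β : Fin n → ℕ)
    (π' : Equiv.Perm (Fin n)) (β' : Fin n → ℕ) (e : Equiv.Perm (Fin n)) : Prop where
  spiral : IsSpiralDecomp π' m β'
  block : ∀ i, β' (e i) = β i
  block_one : ∀ i j, β i = β j → β i % 4 = 1 →
    (e i < e j ↔ i < j) ∧ (π' (e i) < π' (e j) ↔ π j < π i)
  block_two : ∀ i j, β i = β j → β i % 4 = 2 →
    (e i < e j ↔ i < j) ∧ (π' (e i) < π' (e j) ↔ π i < π j)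
  block_three : ∀ i j, β i = β j → β i % 4 = 3 →
    (e i < e j ↔ j < i) ∧ (π' (e i) < π' (e j) ↔ π i < π j)
  block_zero : ∀ i j, β i = β j → β i % 4 = 0 →
    (e i < e j ↔ j < i) ∧ (π' (e i) < π' (e j) ↔ π j < π i)
  next_zero : ∀ i j, β j = β i + 1 → β i % 4 = 0 → (π' (e j) < π' (e i) ↔ π i < π j)
  next_one : ∀ i j, β j = β i + 1 → β i % 4 = 1 → (e j < e i ↔ j < i)
  next_two : ∀ i j, β j = β i + 1 → β i % 4 = 2 → (π' (e j) < π' (e i) ↔ π j < π i)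
  next_three : ∀ i j, β j = β i + 1 → β i % 4 = 3 → (e j < e i ↔ i < j)

/-- Horizontal coordinate in the twirl of the element at position `i`. The blocks `B_{2p-1}` and
`B_{2p}` share columns; this group of columns is kept for odd `p`, and put to the left of the
center (first component `0`), and reversed for even `p`, and put to the right of the center (first
component `1`). -/
def twirlX {n : ℕ} (β : Fin n → ℕ) (i : Fin n) : ℕ ×ₗ ℤ :=
  let p := (β i + 1) / 2
  let x : ℤ := ((i : ℕ) : ℤ) + (n : ℤ) * (p : ℤ)
  if Odd p then toLex (0, x) else toLex (1, -x)

/-- Vertical coordinate in the twirl of the element at position `i`. The blocks `B_{2q}` and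
`B_{2q+1}` share rows; this group of rows is kept for odd `q`, and put below the center (first
component `0`), and reversed for even `q`, and put above the center (first component `1`). -/
def twirlY {n : ℕ} (π : Equiv.Perm (Fin n)) (β : Fin n → ℕ) (i : Fin n) : ℕ ×ₗ ℤ :=
  let q := β i / 2
  let y : ℤ := ((π i : ℕ) : ℤ) + (n : ℤ) * (q : ℤ)
  if Odd q then toLex (0, y) else toLex (1, -y)

/-- The twirl of `π` with respect to the decomposition `β`. -/
def twirl {n : ℕ} (π : Equiv.Perm (Fin n)) (β : Fin n → ℕ) : Equiv.Perm (Fin n) :=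
  ofPoints (twirlX β) (twirlY π β)

/-! ### Tracks and spirals -/

/-- The sequence whose reduction is the `k`-track:
`1, 2k, 3, 2k+2, 5, 2k+4, …, k²-1, k²+2k-2` for even `k`, and
`1, 2k, 3, 2k+2, 5, 2k+4, …, k²-k-1, k²+k-2, k²-k+1, k²-k+3, …, k²+k-1` for odd `k`. -/
def trackSeq (k : ℕ) (t : Fin (k ^ 2)) : ℕ :=
  if Odd k ∧ k * (k - 1) ≤ (t : ℕ) then k * (k - 1) + 1 + 2 * ((t : ℕ) - k * (k - 1))
  else if Even (t : ℕ) then (t : ℕ) + 1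
  else 2 * k + ((t : ℕ) - 1)

/-- The `k`-track. -/
def kTrack (k : ℕ) : Equiv.Perm (Fin (k ^ 2)) := reduction (trackSeq k)

/-- The stair-decomposition of the `k`-track into blocks `A_1, …, A_k` of size `k`: the block of
the element at position `t`. The positions are divided into groups of `2k` positions (the last
group has `k` positions for odd `k`), and in the `j`th group the elements of `A_{2j-1}` alternate
with those of `A_{2j}` (for odd `k` the last group is `A_k`). -/
def trackBlock (k : ℕ) (t : Fin (k ^ 2)) : ℕ :=
  if Odd k ∧ k * (k - 1) ≤ (t : ℕ) then k
  else if Even (t : ℕ) then 2 * ((t : ℕ) / (2 * k)) + 1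
  else 2 * ((t : ℕ) / (2 * k)) + 2

/-- The `k`-spiral: the twirl of the `k`-track with respect to its stair-decomposition. -/
def kSpiral (k : ℕ) : Equiv.Perm (Fin (k ^ 2)) := twirl (kTrack k) (trackBlock k)

end PermPattern

namespace PermPattern

theorem sort_symm_lt_iff {n : ℕ} {α : Type*} [LinearOrder α] {f : Fin n → α}
    (hf : Function.Injective f) (i j : Fin n) :
    (Tuple.sort f).symm i < (Tuple.sort f).symm j ↔ f i < f j := by
  have hm : StrictMono (f ∘ Tuple.sort f) :=
    (Tuple.monotone_sort f).strictMono_of_injective (hf.comp (Tuple.sort f).injective)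
  simpa using (hm.lt_iff_lt (a := (Tuple.sort f).symm i) (b := (Tuple.sort f).symm j)).symm

theorem ofPoints_apply_sort_symm {n : ℕ} {α : Type*} [LinearOrder α] (x y : Fin n → α)
    (i : Fin n) : ofPoints x y ((Tuple.sort x).symm i) = (Tuple.sort y).symm i := by
  simp [ofPoints]

theorem group_lt_iff {n a b : ℕ} (ha : a < n) (hb : b < n) (p q : ℕ) :
    (a : ℤ) + n * p < b + n * q ↔ p < q ∨ (p = q ∧ a < b) := by
  rcases lt_trichotomy p q with h | h | h
  · have h1 : (n : ℤ) * (p + 1) ≤ n * q := by exact_mod_cast Nat.mul_le_mul_left n h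
    constructor
    · intro _; exact Or.inl h
    · intro _; nlinarith
  · subst h; simp
  · have h1 : (n : ℤ) * (q + 1) ≤ n * p := by exact_mod_cast Nat.mul_le_mul_left n h
    constructor
    · intro _; nlinarith
    · rintro (h2 | h2) <;> omega

/-- The order of the points of `twirlX` and `twirlY`. -/
theorem twirl_key_lt_iff {n a b : ℕ} (ha : a < n) (hb : b < n) (p q : ℕ) :
    ((if Odd p then toLex (0, (a : ℤ) + n * p) else toLex (1, -((a : ℤ) + n * p)) : ℕ ×ₗ ℤ) <
      if Odd q then toLex (0, (b : ℤ) + n * q) else toLex (1, -((b : ℤ) + n * q))) ↔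
    (Odd p ∧ ¬ Odd q) ∨ (Odd p ∧ Odd q ∧ (p < q ∨ (p = q ∧ a < b))) ∨
      (¬ Odd p ∧ ¬ Odd q ∧ (q < p ∨ (p = q ∧ b < a))) := by
  have h1 := group_lt_iff ha hb p q
  have h2 := group_lt_iff hb ha q p
  by_cases hp : Odd p <;> by_cases hq : Odd q <;>
    simp only [hp, hq, if_true, if_false, Prod.Lex.toLex_lt_toLex, neg_lt_neg_iff, h1, h2] <;>
    simp [eq_comm]

theorem twirlX_lt_iff {n : ℕ} (β : Fin n → ℕ) (i j : Fin n) :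
    twirlX β i < twirlX β j ↔
    (Odd ((β i + 1) / 2) ∧ ¬ Odd ((β j + 1) / 2)) ∨
      (Odd ((β i + 1) / 2) ∧ Odd ((β j + 1) / 2) ∧
        ((β i + 1) / 2 < (β j + 1) / 2 ∨ ((β i + 1) / 2 = (β j + 1) / 2 ∧ (i : ℕ) < j))) ∨
      (¬ Odd ((β i + 1) / 2) ∧ ¬ Odd ((β j + 1) / 2) ∧
        ((β j + 1) / 2 < (β i + 1) / 2 ∨ ((β i + 1) / 2 = (β j + 1) / 2 ∧ (j : ℕ) < i))) :=
  twirl_key_lt_iff i.2 j.2 _ _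

theorem twirlY_lt_iff {n : ℕ} (π : Equiv.Perm (Fin n)) (β : Fin n → ℕ) (i j : Fin n) :
    twirlY π β i < twirlY π β j ↔
    (Odd (β i / 2) ∧ ¬ Odd (β j / 2)) ∨
      (Odd (β i / 2) ∧ Odd (β j / 2) ∧
        (β i / 2 < β j / 2 ∨ (β i / 2 = β j / 2 ∧ (π i : ℕ) < π j))) ∨
      (¬ Odd (β i / 2) ∧ ¬ Odd (β j / 2) ∧
        (β j / 2 < β i / 2 ∨ (β i / 2 = β j / 2 ∧ (π j : ℕ) < π i))) :=
  twirl_key_lt_iff (π i).2 (π j).2 _ _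

theorem twirlX_injective {n : ℕ} (β : Fin n → ℕ) : Function.Injective (twirlX β) := by
  intro i j h
  have h1 := (twirlX_lt_iff β i j).not.1 (by rw [h]; exact lt_irrefl _)
  have h2 := (twirlX_lt_iff β j i).not.1 (by rw [h]; exact lt_irrefl _)
  simp only [Nat.odd_iff] at h1 h2
  apply Fin.ext
  omega

theorem twirlY_injective {n : ℕ} (π : Equiv.Perm (Fin n)) (β : Fin n → ℕ) :
    Function.Injective (twirlY π β) := by
  intro i j h
  have h1 := (twirlY_lt_iff π β i j).not.1 (by rw [h]; exact lt_irrefl _)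
  have h2 := (twirlY_lt_iff π β j i).not.1 (by rw [h]; exact lt_irrefl _)
  simp only [Nat.odd_iff] at h1 h2
  apply π.injective
  apply Fin.ext
  omega

theorem isTwirl_of_lt_iff {n : ℕ} {π : Equiv.Perm (Fin n)} {m : ℕ} {β : Fin n → ℕ}
    (h : IsStairDecomp π m β) {π' e : Equiv.Perm (Fin n)}
    (hx : ∀ i j, e i < e j ↔ twirlX β i < twirlX β j)
    (hy : ∀ i j, π' (e i) < π' (e j) ↔ twirlY π β i < twirlY π β j) :
    IsTwirl π m β π' (β ∘ e.symm) e := by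
  have inc : ∀ i j, β i = β j → ((i : ℕ) < j ↔ (π i : ℕ) < π j) := by
    intro i j hij
    have h1 := h.increasing i j hij
    have h2 := h.increasing j i hij.symm
    rcases lt_trichotomy i j with h3 | h3 | h3
    · exact ⟨fun _ => h1 h3, fun _ => h3⟩
    · subst h3; simp
    · have h4 : (π j : ℕ) < π i := h2 h3
      have h5 : (j : ℕ) < i := h3
      omega
  simp only [twirlX_lt_iff, twirlY_lt_iff, Nat.odd_iff] at hx hy
  have spiral : IsSpiralDecomp π' m (β ∘ e.symm) := by
    refine ⟨fun i => h.range _, ?_, ?_, ?_, ?_, ?_, ?_, ?_, ?_, ?_, ?_⟩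
    all_goals
      intro i j
      obtain ⟨i, rfl⟩ := e.surjective i
      obtain ⟨j, rfl⟩ := e.surjective j
      have h5 := inc i j
      have h5b := inc j i
      have h6 := h.range i
      simp only [Nat.odd_iff, Nat.even_iff, Function.comp_apply, Equiv.symm_apply_apply, hx, hy]
      generalize (β i) = b at *
      generalize (β j) = c at *
      generalize (i : ℕ) = b1 at *
      generalize (j : ℕ) = c1 at *
      generalize ((π i : Fin n) : ℕ) = b2 at *
      generalize ((π j : Fin n) : ℕ) = c2 at *
      clear hx hy inc h
      omega
  refine ⟨spiral, fun i => by simp, ?_, ?_, ?_, ?_, ?_, ?_, ?_, ?_⟩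
  all_goals
    intro i j
    have h5 := inc i j
    have h6 := h.range i
    simp only [hx, hy]
    simp only [Fin.lt_def]
    generalize (β i) = b at *
    generalize (β j) = c at *
    generalize (i : ℕ) = b1 at *
    generalize (j : ℕ) = c1 at *
    generalize ((π i : Fin n) : ℕ) = b2 at *
    generalize ((π j : Fin n) : ℕ) = c2 at *
    clear hx hy inc h spiral
    omega

/-- The permutation `twirl π β` obeys the rules that define the twirl. -/
theorem isTwirl_twirl {n : ℕ} {π : Equiv.Perm (Fin n)} {m : ℕ} {β : Fin n → ℕ}
    (h : IsStairDecomp π m β) :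
    IsTwirl π m β (twirl π β) (β ∘ Tuple.sort (twirlX β)) (Tuple.sort (twirlX β)).symm := by
  refine isTwirl_of_lt_iff h (fun i j => sort_symm_lt_iff (twirlX_injective β) i j) fun i j => ?_
  rw [twirl, ofPoints_apply_sort_symm, ofPoints_apply_sort_symm]
  exact sort_symm_lt_iff (twirlY_injective π β) i j

end PermPattern

namespace PermPattern

theorem track_cases (k : ℕ) (t : Fin (k ^ 2)) : ∃ g s : ℕ, (t : ℕ) = 2 * k * g + s ∧ s < 2 * k ∧
    ((k = 2 * g + 1 ∧ s < k ∧ trackBlock k t = 2 * g + 1 ∧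
        trackSeq k t = 2 * k * g + 1 + 2 * s) ∨
      (2 * g + 2 ≤ k ∧ s % 2 = 0 ∧ trackBlock k t = 2 * g + 1 ∧
        trackSeq k t = 2 * k * g + s + 1) ∨
      (2 * g + 2 ≤ k ∧ s % 2 = 1 ∧ trackBlock k t = 2 * g + 2 ∧
        trackSeq k t = 2 * k * g + 2 * k + s - 1)) := by
  have ht : (t : ℕ) < k * k := by simpa [pow_two] using t.2
  have hk : 0 < 2 * k := by
    rcases Nat.eq_zero_or_pos k with h | h
    · subst h; omega
    · omega
  have hts := Nat.div_add_mod (t : ℕ) (2 * k)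
  have hs := Nat.mod_lt (t : ℕ) hk
  refine ⟨(t : ℕ) / (2 * k), (t : ℕ) % (2 * k), hts.symm, hs, ?_⟩
  unfold trackBlock trackSeq
  generalize hg : (t : ℕ) / (2 * k) = g at *
  generalize (t : ℕ) % (2 * k) = s at *
  have hpar : (2 * k * g) % 2 = 0 := by rw [mul_assoc]; omega
  by_cases hodd : Odd k
  · obtain ⟨h, hh⟩ := hodd
    have hM : k * (k - 1) = 2 * k * h := by
      have : k - 1 = 2 * h := by omega
      rw [this]; ring
    have hodd : Odd k := ⟨h, hh⟩
    have hkk : k * k = 2 * k * h + k := by rw [hh]; ring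
    by_cases hl : k * (k - 1) ≤ (t : ℕ)
    · have hgh : g = h := by
        rcases lt_trichotomy g h with h1 | h1 | h1
        · have := Nat.mul_le_mul_left (2 * k) h1
          rw [Nat.mul_succ] at this
          omega
        · exact h1
        · have := Nat.mul_le_mul_left (2 * k) h1
          rw [Nat.mul_succ] at this
          omega
      subst hgh
      left
      simp only [hodd, hl, and_self, if_true]
      refine ⟨hh, by omega, hh, ?_⟩
      omega
    · have hgh : g < h := by
        by_contra h1
        have := Nat.mul_le_mul_left (2 * k) (not_lt.1 h1)
        omega
      right
      simp only [hodd, hl, and_false, if_false, Nat.even_iff]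
      split_ifs <;> omega
  · right
    have hgk : g < k / 2 := by
      by_contra h1
      have := Nat.mul_le_mul_left (2 * k) (not_lt.1 h1)
      have h2 : k = 2 * (k / 2) := by
        have := Nat.not_odd_iff_even.1 hodd
        have := Nat.even_iff.1 this
        omega
      have h3 : 2 * k * (k / 2) = k * k := by
        calc 2 * k * (k / 2) = k * (2 * (k / 2)) := by ring
          _ = k * k := by rw [← h2]
      omega
    simp only [hodd, false_and, if_false, Nat.even_iff]
    split_ifs <;> omega

theorem trackSeq_injective (k : ℕ) : Function.Injective (trackSeq k) := by
  intro t t' h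
  obtain ⟨g, s, h1, h2, h3⟩ := track_cases k t
  obtain ⟨g', s', h1', h2', h3'⟩ := track_cases k t'
  have hpar : (2 * k * g) % 2 = 0 := by rw [mul_assoc]; omega
  have hpar' : (2 * k * g') % 2 = 0 := by rw [mul_assoc]; omega
  apply Fin.ext
  rcases lt_trichotomy g g' with h4 | h4 | h4
  · have := Nat.mul_le_mul_left (2 * k) h4
    rw [Nat.mul_succ] at this
    omega
  · subst h4
    omega
  · have := Nat.mul_le_mul_left (2 * k) h4
    rw [Nat.mul_succ] at this
    omega

/-- The blocks given by `trackBlock` form a stair-decomposition of the `k`-track. -/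
theorem isStairDecomp_trackBlock (k : ℕ) : IsStairDecomp (kTrack k) k (trackBlock k) := by
  have hlt : ∀ i j, kTrack k i < kTrack k j ↔ trackSeq k i < trackSeq k j :=
    sort_symm_lt_iff (trackSeq_injective k)
  refine ⟨fun i => ?_, ?_, ?_, ?_, ?_⟩
  · obtain ⟨g, s, h1, h2, h3⟩ := track_cases k i
    omega
  all_goals
    intro i j
    simp only [hlt, Fin.lt_def, Nat.odd_iff, Nat.even_iff]
    obtain ⟨g, s, h1, h2, h3⟩ := track_cases k i
    obtain ⟨g', s', h1', h2', h3'⟩ := track_cases k j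
    have hpar : (2 * k * g) % 2 = 0 := by rw [mul_assoc]; omega
    have hpar' : (2 * k * g') % 2 = 0 := by rw [mul_assoc]; omega
    by_cases h4 : g' = g
    · subst h4
      omega
    · by_cases h5 : g' = g + 1
      · subst h5
        have h6 : 2 * k * (g + 1) = 2 * k * g + 2 * k := by ring
        rw [h6] at h1' h3' hpar'
        generalize 2 * k * g = P at *
        omega
      · omega

end PermPattern

/-!
A permutation avoiding `2143` and `3412` has a center, a horizontal and a vertical line that divide
it into two increasing and two decreasing quadrants. Two cyclically consecutive quadrants share a
half-plane, in which their points are ordered by their depth towards the center, and the absence of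
`3142` means that no cycle around the center leads inwards at every step. Hence the greedy sequence
that turns around the center, always moving to the next quadrant and inwards, winds up into a spiral
that cuts the quadrants into blocks `1, 2, 3, …`. Two consecutive blocks form a strip, the depth
orders of the strips have a common linear extension `τ`, the time, and apart from two points on the
lines every edge of the graph joins consecutive points of a strip or contains a point of the greedy
sequence and stays within four blocks.

If block `t` has no point that is preceded by `h` levels of points alternating between neighbouring
blocks, then following the first points of each level backwards in time yields a separator with
`O(h)` vertices close to block `t`. Between two such separators that are not far apart, the points
before a given time are separated from the others by `O(h)` vertices as well. A large wall cannot
be on both sides of a small separator, and it cannot pass from one side to the other if the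
separator moves one vertex at a time. So a wall of height at least a constant times `k` forces `k`
consecutive blocks with points of `3 * k` levels. The first points of suitable levels alternate like
a `k`-track, and around the center a track becomes a spiral or, if it starts in the opposite
quadrant, the reverse-complement of one.
-/

namespace PermPattern

/-! ### Walls and meshes -/

section SubdivisionImage

variable {U V W : Type*} {G : SimpleGraph V} {H : SimpleGraph W} {K : SimpleGraph U} {φ : W → V}

/-- The vertices of the part of a subdivision, with branch vertices `φ` and paths `P`, that
subdivides the edges of the image of `f`. -/
def subdivisionImage (P : ∀ u v : W, H.Adj u v → G.Walk (φ u) (φ v)) (f : K →g H) : Set V :=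
  {x | ∃ u v, ∃ h : K.Adj u v, x ∈ (P _ _ (f.map_adj h)).support}

theorem mem_subdivisionImage [Nontrivial U] (P : ∀ u v : W, H.Adj u v → G.Walk (φ u) (φ v))
    (f : K →g H) (hK : K.Preconnected) (u : U) : φ (f u) ∈ subdivisionImage P f := by
  obtain ⟨v, huv⟩ := hK.exists_adj_of_nontrivial u
  exact ⟨u, v, huv, SimpleGraph.Walk.start_mem_support _⟩

theorem preconnected_induce_subdivisionImage [Nontrivial U]
    (P : ∀ u v : W, H.Adj u v → G.Walk (φ u) (φ v)) (f : K →g H) (hK : K.Preconnected) :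
    (G.induce (subdivisionImage P f)).Preconnected := by
  have reachable_of_adj : ∀ u v (h : K.Adj u v) x (hx : x ∈ (P _ _ (f.map_adj h)).support),
      (G.induce (subdivisionImage P f)).Reachable
        ⟨φ (f u), mem_subdivisionImage P f hK u⟩ ⟨x, u, v, h, hx⟩ := by
    classical
    intro u v h x hx
    exact (((P _ _ (f.map_adj h)).takeUntil x hx).induce (subdivisionImage P f) fun y hy =>
      ⟨u, v, h, (P _ _ (f.map_adj h)).support_takeUntil_subset_support hx hy⟩).reachable
  have reachable_branch : ∀ u v, (G.induce (subdivisionImage P f)).Reachable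
      ⟨φ (f u), mem_subdivisionImage P f hK u⟩ ⟨φ (f v), mem_subdivisionImage P f hK v⟩ := by
    intro u v
    obtain ⟨p⟩ := hK u v
    induction p with
    | nil => rfl
    | cons h _ ih => exact (reachable_of_adj _ _ h _ (SimpleGraph.Walk.end_mem_support _)).trans ih
  rintro ⟨x, u, v, h, hx⟩ ⟨y, u', v', h', hy⟩
  exact (reachable_of_adj u v h x hx).symm.trans
    ((reachable_branch u u').trans (reachable_of_adj u' v' h' y hy))

theorem disjoint_subdivisionImage {P : ∀ u v : W, H.Adj u v → G.Walk (φ u) (φ v)}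
    (hP : ∀ u v (h : H.Adj u v) u' v' (h' : H.Adj u' v'), s(u, v) ≠ s(u', v') →
      ∀ x, x ∈ (P u v h).support → x ∈ (P u' v' h').support →
        ∃ w, x = φ w ∧ (w = u ∨ w = v) ∧ (w = u' ∨ w = v'))
    {f g : K →g H} (hfg : ∀ u v, f u ≠ g v) :
    Disjoint (subdivisionImage P f) (subdivisionImage P g) := by
  rw [Set.disjoint_left]
  rintro x ⟨u, v, h, hx⟩ ⟨u', v', h', hx'⟩
  have hne : s(f u, f v) ≠ s(g u', g v') := fun e =>
    (Sym2.eq_iff.1 e).elim (fun e => hfg _ _ e.1) fun e => hfg _ _ e.1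
  obtain ⟨w, -, rfl | rfl, e | e⟩ := hP _ _ _ _ _ _ hne x hx hx' <;> exact hfg _ _ e

end SubdivisionImage

/-- Disjoint connected rows and disjoint connected columns such that every row meets every
column: what is left of a wall of height `m` in the counting arguments. -/
structure IsMesh {V : Type*} (G : SimpleGraph V) {m : ℕ} (R C : Fin m → Set V) : Prop where
  row_preconnected : ∀ i, (G.induce (R i)).Preconnected
  col_preconnected : ∀ j, (G.induce (C j)).Preconnected
  row_disjoint : Pairwise fun i j => Disjoint (R i) (R j)
  col_disjoint : Pairwise fun i j => Disjoint (C i) (C j)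
  meet : ∀ i j, (R i ∩ C j).Nonempty

/-- The `i`th row of the elementary wall without its end vertices. -/
def wallRow {r : ℕ} (i : Fin r) : SimpleGraph.pathGraph (2 * r) →g elementaryWall r where
  toFun n := ⟨(i + 1, n + 2), by simp only [ne_eq, Prod.mk.injEq]; omega⟩
  map_rel' := by
    intro a b hab
    rw [SimpleGraph.pathGraph_adj] at hab
    simp only [elementaryWall, WallRemoved, Nat.dist]
    omega

/-- The path that zigzags down the columns `2j + 2` and `2j + 3` of the elementary wall. -/
def wallColumn {r : ℕ} (j : Fin r) :
    SimpleGraph.pathGraph (2 * (r + 1)) →g elementaryWall r where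
  toFun n := ⟨(n / 2 + 1, if (n : ℕ) % 4 = 0 ∨ (n : ℕ) % 4 = 3 then 2 * j + 2 else 2 * j + 3), by
    simp only [ne_eq, Prod.mk.injEq]; split_ifs <;> omega⟩
  map_rel' := by
    intro a b hab
    rw [SimpleGraph.pathGraph_adj] at hab
    simp only [elementaryWall, WallRemoved, Nat.dist, Nat.odd_iff, Nat.even_iff]
    split_ifs <;> omega

theorem val_wallRow {r : ℕ} (i : Fin r) (n : Fin (2 * r)) :
    (wallRow i n).1 = ((i : ℕ) + 1, (n : ℕ) + 2) := rfl

theorem val_wallColumn {r : ℕ} (j : Fin r) (n : Fin (2 * (r + 1))) :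
    (wallColumn j n).1 = ((n : ℕ) / 2 + 1,
      if (n : ℕ) % 4 = 0 ∨ (n : ℕ) % 4 = 3 then 2 * (j : ℕ) + 2 else 2 * (j : ℕ) + 3) := rfl

theorem exists_wallRow_eq_wallColumn {r : ℕ} (i j : Fin r) :
    ∃ a b, wallRow i a = wallColumn j b := by
  refine ⟨⟨if (i : ℕ) % 2 = 0 then 2 * j else 2 * j + 1, by split_ifs <;> omega⟩,
    ⟨2 * i, by omega⟩, Subtype.ext ?_⟩
  simp only [val_wallRow, val_wallColumn, Prod.mk.injEq]
  split_ifs <;> omega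

theorem exists_isMesh_of_containsWall {V : Type*} {G : SimpleGraph V} {r : ℕ}
    (h : ContainsWall G r) : ∃ R C : Fin r → Set V, IsMesh G R C := by
  obtain ⟨φ, P, -, -, -, -, hP⟩ := h
  have nontrivial_row (i : Fin r) : Nontrivial (Fin (2 * r)) :=
    Fin.nontrivial_iff_two_le.2 (by have := i.2; omega)
  have nontrivial_column : Nontrivial (Fin (2 * (r + 1))) :=
    Fin.nontrivial_iff_two_le.2 (by omega)
  have hrow := SimpleGraph.pathGraph_preconnected (2 * r)
  have hcol := SimpleGraph.pathGraph_preconnected (2 * (r + 1))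
  refine ⟨fun i => subdivisionImage P (wallRow i), fun j => subdivisionImage P (wallColumn j),
    fun i => ?_, fun j => preconnected_induce_subdivisionImage P _ hcol,
    fun i j hij => disjoint_subdivisionImage hP fun a b e => ?_,
    fun i j hij => disjoint_subdivisionImage hP fun a b e => ?_, fun i j => ?_⟩
  · have := nontrivial_row i
    exact preconnected_induce_subdivisionImage P _ hrow
  · have e := congrArg (fun p => p.1.1) e
    simp only [val_wallRow] at e
    omega
  · have e := congrArg (fun p => p.1.2) e
    simp only [val_wallColumn] at e
    split_ifs at e <;> omega
  · have := nontrivial_row i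
    obtain ⟨a, b, hab⟩ := exists_wallRow_eq_wallColumn i j
    exact ⟨φ (wallRow i a), mem_subdivisionImage P _ hrow a,
      hab ▸ mem_subdivisionImage P _ hcol b⟩

/-- `X` separates `S` from its complement. -/
def Separates {V : Type*} (G : SimpleGraph V) (X S : Set V) : Prop :=
  ∀ ⦃x y⦄, x ∉ X → y ∉ X → G.Adj x y → x ∈ S → y ∈ S

theorem Separates.subset_of_preconnected {V : Type*} {G : SimpleGraph V} {X S K : Set V}
    (hS : Separates G X S) (hK : (G.induce K).Preconnected) (hKX : Disjoint K X)
    (hKS : (K ∩ S).Nonempty) : K ⊆ S := by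
  obtain ⟨x, hxK, hxS⟩ := hKS
  intro y hy
  obtain ⟨p⟩ := hK ⟨x, hxK⟩ ⟨y, hy⟩
  suffices ∀ a b : K, (G.induce K).Walk a b → (a : V) ∈ S → (b : V) ∈ S from this _ _ p hxS
  intro a b p
  induction p with
  | nil => exact id
  | @cons a b _ h _ ih =>
    exact fun ha => ih (hS (hKX.notMem_of_mem_left a.2) (hKX.notMem_of_mem_left b.2) h ha)

theorem exists_disjoint_of_card_lt {V ι : Type*} [Fintype ι] {R : ι → Set V}
    (hR : Pairwise fun i j => Disjoint (R i) (R j)) {X : Finset V}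
    (hX : X.card < Fintype.card ι) : ∃ i, Disjoint (R i) X := by
  by_contra! hcon
  choose f hfR hfX using fun i => Set.not_disjoint_iff.1 (hcon i)
  have hf : Function.Injective f := fun i j hij => by
    by_contra hne
    exact Set.disjoint_left.1 (hR hne) (hfR i) (hij ▸ hfR j)
  have := Finset.card_le_card_of_injOn f (s := Finset.univ) (fun i _ => hfX i) hf.injOn
  rw [Finset.card_univ] at this
  omega

/-- Some row that avoids `X` is contained in `S`. If `X` separates `S` and has fewer elements than
the mesh has rows, this selects the side of the separation on which the mesh lies. -/
def LiesIn {V : Type*} {m : ℕ} (R : Fin m → Set V) (X S : Set V) : Prop :=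
  ∃ i, Disjoint (R i) X ∧ R i ⊆ S

namespace IsMesh

variable {V : Type*} {G : SimpleGraph V} {m : ℕ} {R C : Fin m → Set V}

theorem row_nonempty (h : IsMesh G R C) (i : Fin m) : (R i).Nonempty :=
  (h.meet i i).mono Set.inter_subset_left

theorem not_liesIn_empty (h : IsMesh G R C) (X : Set V) : ¬ LiesIn R X ∅ := by
  rintro ⟨i, -, hi⟩
  exact (h.row_nonempty i).ne_empty (Set.subset_empty_iff.1 hi)

theorem exists_row_disjoint (h : IsMesh G R C) {X : Finset V} (hX : X.card < m) :
    ∃ i, Disjoint (R i) X :=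
  exists_disjoint_of_card_lt h.row_disjoint (by simpa using hX)

theorem exists_col_disjoint (h : IsMesh G R C) {X : Finset V} (hX : X.card < m) :
    ∃ j, Disjoint (C j) X :=
  exists_disjoint_of_card_lt h.col_disjoint (by simpa using hX)

theorem row_subset_of_liesIn (h : IsMesh G R C) {X : Finset V} {S : Set V} (hS : Separates G X S)
    (hX : X.card < m) (hin : LiesIn R X S) {i : Fin m} (hi : Disjoint (R i) X) : R i ⊆ S := by
  obtain ⟨j, -, hjS⟩ := hin
  obtain ⟨l, hl⟩ := h.exists_col_disjoint hX
  have hlS : C l ⊆ S := hS.subset_of_preconnected (h.col_preconnected l) hl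
    ((h.meet j l).mono fun _ hx => ⟨hx.2, hjS hx.1⟩)
  exact hS.subset_of_preconnected (h.row_preconnected i) hi
    ((h.meet i l).mono (Set.inter_subset_inter_right _ hlS))

theorem row_disjoint_of_not_liesIn (h : IsMesh G R C) {X S : Set V} (hS : Separates G X S)
    (hout : ¬ LiesIn R X S) {i : Fin m} (hi : Disjoint (R i) X) : Disjoint (R i) S := by
  by_contra hmeet
  exact hout ⟨i, hi, hS.subset_of_preconnected (h.row_preconnected i) hi
    (Set.not_disjoint_iff_nonempty_inter.1 hmeet)⟩

theorem exists_row_subset_diff [DecidableEq V] (h : IsMesh G R C) {X X' : Finset V} {S S' : Set V}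
    (hS : Separates G X S) (hS' : Separates G X' S') (hout : ¬ LiesIn R X S)
    (hin : LiesIn R X' S') (F : Finset V) (hcard : (X ∪ X' ∪ F).card < m) :
    ∃ i, Disjoint (R i) F ∧ R i ⊆ S' \ S := by
  obtain ⟨i, hi⟩ := h.exists_row_disjoint hcard
  simp only [Finset.coe_union, Set.disjoint_union_right] at hi
  obtain ⟨⟨hiX, hiX'⟩, hiF⟩ := hi
  have hX' : X'.card < m := (Finset.card_le_card
    (Finset.subset_union_right.trans Finset.subset_union_left)).trans_lt hcard
  exact ⟨i, hiF, Set.subset_sdiff.2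
    ⟨h.row_subset_of_liesIn hS' hX' hin hiX', h.row_disjoint_of_not_liesIn hS hout hiX⟩⟩

theorem liesIn_of_diff_subset [DecidableEq V] (h : IsMesh G R C) {X X' F : Finset V} {S S' : Set V}
    (hS : Separates G X S) (hS' : Separates G X' S') (hin : LiesIn R X' S')
    (hcard : (X ∪ X' ∪ F).card < m) (hF : S' \ S ⊆ F) : LiesIn R X S := by
  by_contra hout
  obtain ⟨i, hiF, hi⟩ := h.exists_row_subset_diff hS hS' hout hin F hcard
  obtain ⟨a, ha⟩ := h.row_nonempty i
  exact hiF.notMem_of_mem_left ha (hF (hi ha))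

end IsMesh

/-! ### Spiralling systems -/

/-- Points in four cyclically ordered arms, where the points of two cyclically consecutive arms are
compared by their depth and no cycle around the arms goes deeper at every step. Indices are read
modulo `4`, and `key i` is the depth in the arms `i` and `i + 1`. -/
structure SpiralSystem (V : Type*) where
  arm : V → ℕ
  key : ℕ → V → ℕ
  key_mod : ∀ i z, key (i + 4) z = key i z
  key_inj : ∀ i x y, (arm x % 4 = i % 4 ∨ arm x % 4 = (i + 1) % 4) →
    (arm y % 4 = i % 4 ∨ arm y % 4 = (i + 1) % 4) → key i x = key i y → x = y
  key_succ : ∀ i x y, arm x % 4 = (i + 1) % 4 → arm y % 4 = (i + 1) % 4 →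
    (key i x < key i y ↔ key (i + 1) x < key (i + 1) y)
  acyclic : ∀ i a b c d, arm a % 4 = i % 4 → arm b % 4 = (i + 1) % 4 → arm c % 4 = (i + 2) % 4 →
    arm d % 4 = (i + 3) % 4 → key i a < key i b → key (i + 1) b < key (i + 1) c →
    key (i + 2) c < key (i + 2) d → ¬ key (i + 3) d < key (i + 3) a

/-- Strip `t` of a set of points partitioned into blocks by `β` consists of the blocks `t` and
`t + 1`. -/
abbrev InStrip {V : Type*} (β : V → ℕ) (t : ℕ) (z : V) : Prop := β z = t ∨ β z = t + 1

/-- The point `y` is the next point after `x` in strip `t` in the order of the times `τ`. -/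
structure Consecutive {V : Type*} (β τ : V → ℕ) (t : ℕ) (x y : V) : Prop where
  left : InStrip β t x
  right : InStrip β t y
  lt : τ x < τ y
  le_of_lt : ∀ w, InStrip β t w → τ x < τ w → τ y ≤ τ w

namespace SpiralSystem

variable {V : Type*} (Y : SpiralSystem V)

theorem key_congr {i j : ℕ} (h : i % 4 = j % 4) (z : V) : Y.key i z = Y.key j z := by
  have hperiodic : Function.Periodic (Y.key · z) 4 := fun i => Y.key_mod i z
  rw [← hperiodic.map_mod_nat i, ← hperiodic.map_mod_nat j, h]

/-- The points of arm `i` from the `i`th point of a greedy spiral on: the spiral begins with the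
first points of four consecutive arms, and every further point of it is the first one in the next
arm that is deeper than the preceding point. -/
def upper : ℕ → Set V
  | 0 => {z | Y.arm z % 4 = 0}
  | i + 1 => {z | Y.arm z % 4 = (i + 1) % 4 ∧
      (i < 4 ∨ ∃ x ∈ upper i, Y.key i x < Y.key i z)}

theorem arm_of_mem_upper {i : ℕ} {z : V} (h : z ∈ Y.upper i) : Y.arm z % 4 = i % 4 := by
  cases i with
  | zero => exact h
  | succ i => exact h.1

theorem mem_upper_of_le {i : ℕ} {z : V} (hi : i ≤ 4) (h : Y.arm z % 4 = i % 4) :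
    z ∈ Y.upper i := by
  cases i with
  | zero => exact h
  | succ i => exact ⟨h, Or.inl (by omega)⟩

theorem exists_of_mem_upper_succ {i : ℕ} {z : V} (hi : 4 ≤ i) (hz : z ∈ Y.upper (i + 1)) :
    ∃ x ∈ Y.upper i, Y.key i x < Y.key i z :=
  hz.2.resolve_left (by omega)

theorem mem_upper_of_key_le {i : ℕ} {x y : V} (hx : x ∈ Y.upper i)
    (hy : Y.arm y % 4 = i % 4 ∨ Y.arm y % 4 = (i + 1) % 4) (h : Y.key i x ≤ Y.key i y) :
    y ∈ Y.upper i ∨ y ∈ Y.upper (i + 1) := by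
  have hxi := Y.arm_of_mem_upper hx
  rcases hy with hy | hy
  · left
    cases i with
    | zero => exact hy
    | succ i =>
      refine ⟨hy, hx.2.imp_right fun ⟨w, hw, hwx⟩ => ⟨w, hw, hwx.trans_le ?_⟩⟩
      exact not_lt.1 fun hlt => h.not_gt ((Y.key_succ i y x hy hxi).1 hlt)
  · refine Or.inr ⟨hy, Or.inr ⟨x, hx, h.lt_of_ne fun heq => ?_⟩⟩
    obtain rfl := Y.key_inj i x y (Or.inl hxi) (Or.inr hy) heq
    omega

theorem exists_mem_upper_key_le {i : ℕ} {y : V} (hi : 4 ≤ i)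
    (hy : y ∈ Y.upper i ∨ y ∈ Y.upper (i + 1)) : ∃ w ∈ Y.upper i, Y.key i w ≤ Y.key i y := by
  rcases hy with hy | hy
  · exact ⟨y, hy, le_rfl⟩
  · obtain ⟨w, hw, hlt⟩ := Y.exists_of_mem_upper_succ hi hy
    exact ⟨w, hw, hlt.le⟩

theorem upper_add_four_subset (i : ℕ) : Y.upper (i + 4) ⊆ Y.upper i := by
  induction i with
  | zero => exact fun z hz => Y.mem_upper_of_le (by omega) (Y.arm_of_mem_upper (i := 4) hz)
  | succ i ih =>
    intro z hz
    obtain ⟨x, hx, hxz⟩ := Y.exists_of_mem_upper_succ (by omega : 4 ≤ i + 4) hz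
    rw [Y.key_mod, Y.key_mod] at hxz
    have hz4 := Y.arm_of_mem_upper hz
    exact ⟨by omega, Or.inr ⟨x, ih hx, hxz⟩⟩

theorem upper_antitone {i j : ℕ} (hij : i ≤ j) (h : i % 4 = j % 4) : Y.upper j ⊆ Y.upper i := by
  have hanti : Antitone fun m => Y.upper (i + 4 * m) :=
    antitone_nat_of_succ_le fun m => Y.upper_add_four_subset (i + 4 * m)
  obtain ⟨m, rfl⟩ : ∃ m, j = i + 4 * m := ⟨(j - i) / 4, by omega⟩
  exact hanti (Nat.zero_le m)

/-- The point `z` is the first point of `upper i`, the `i`th point of the greedy spiral. -/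
def IsFirst (i : ℕ) (z : V) : Prop := z ∈ Y.upper i ∧ ∀ y ∈ Y.upper i, Y.key i z ≤ Y.key i y

variable {Y}

theorem IsFirst.eq {i : ℕ} {x y : V} (hx : Y.IsFirst i x) (hy : Y.IsFirst i y) : x = y :=
  Y.key_inj i x y (Or.inl (Y.arm_of_mem_upper hx.1)) (Or.inl (Y.arm_of_mem_upper hy.1))
    (le_antisymm (hx.2 y hy.1) (hy.2 x hx.1))

theorem IsFirst.not_mem_upper_add_four {i : ℕ} {x : V} (hi : 4 ≤ i) (hx : Y.IsFirst i x) :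
    x ∉ Y.upper (i + 4) := by
  intro h
  obtain ⟨d, hd, hdx⟩ := Y.exists_of_mem_upper_succ (by omega) h
  obtain ⟨c, hc, hcd⟩ := Y.exists_of_mem_upper_succ (by omega) hd
  obtain ⟨b, hb, hbc⟩ := Y.exists_of_mem_upper_succ (by omega) hc
  obtain ⟨a, ha, hab⟩ := Y.exists_of_mem_upper_succ (by omega) hb
  exact Y.acyclic i x b c d (Y.arm_of_mem_upper hx.1) (Y.arm_of_mem_upper hb)
    (Y.arm_of_mem_upper hc) (Y.arm_of_mem_upper hd) ((hx.2 a ha).trans_lt hab) hbc hcd hdx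

variable (Y)

theorem exists_isFirst [Finite V] {i : ℕ} (h : (Y.upper i).Nonempty) : ∃ z, Y.IsFirst i z :=
  Set.exists_min_image (Y.upper i) (Y.key i) (Set.toFinite _) h

theorem bddAbove_setOf_mem_upper [Finite V] (z : V) : BddAbove {i | z ∈ Y.upper i} := by
  by_contra hunbounded
  have hmem : ∀ m, z ∈ Y.upper (Y.arm z % 4 + 4 * m) := fun m => by
    obtain ⟨i, hi, hlt⟩ := not_bddAbove_iff.1 hunbounded (Y.arm z % 4 + 4 * m)
    have := Y.arm_of_mem_upper hi
    exact Y.upper_antitone hlt.le (by omega) hi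
  choose first hfirst using fun m => Y.exists_isFirst ⟨z, hmem (m + 1)⟩
  refine not_injective_infinite_finite first (.of_lt_imp_ne fun m n hmn heq => ?_)
  exact (hfirst m).not_mem_upper_add_four (by omega)
    (heq ▸ Y.upper_antitone (by omega) (by omega) (hfirst n).1)

/-- Block `i` consists of the points of arm `i` from the `i`th point of the greedy spiral on and
before its point `i + 4`; this is the index of the block of `z`. -/
noncomputable def block (z : V) : ℕ := sSup {i | z ∈ Y.upper i}

/-- The points of the greedy spiral, which are the first points of their blocks. -/
def IsChain (z : V) : Prop := Y.IsFirst (Y.block z) z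

variable {Y} in
theorem IsChain.eq {x y : V} (hx : Y.IsChain x) (hy : Y.IsChain y) (h : Y.block x = Y.block y) :
    x = y := by
  rw [IsChain, h] at hx
  exact IsFirst.eq hx hy

section Finite

variable [Finite V]

theorem mem_upper_block (z : V) : z ∈ Y.upper (Y.block z) :=
  Nat.sSup_mem ⟨Y.arm z % 4, Y.mem_upper_of_le (by omega) (by omega)⟩
    (Y.bddAbove_setOf_mem_upper z)

theorem arm_mod_four (z : V) : Y.arm z % 4 = Y.block z % 4 :=
  Y.arm_of_mem_upper (Y.mem_upper_block z)

theorem mem_upper_iff {i : ℕ} {z : V} :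
    z ∈ Y.upper i ↔ i % 4 = Y.block z % 4 ∧ i ≤ Y.block z where
  mp h := ⟨by rw [← Y.arm_mod_four, Y.arm_of_mem_upper h],
    le_csSup (Y.bddAbove_setOf_mem_upper z) h⟩
  mpr h := Y.upper_antitone h.2 h.1 (Y.mem_upper_block z)

theorem block_pos (z : V) : 0 < Y.block z := by
  by_contra! hle
  have h4 : z ∈ Y.upper 4 := by
    have := Y.arm_mod_four z
    exact Y.mem_upper_of_le le_rfl (by omega)
  have := (Y.mem_upper_iff.1 h4).2
  omega

theorem exists_inStrip {i : ℕ} {z : V} (h : Y.arm z % 4 = i % 4 ∨ Y.arm z % 4 = (i + 1) % 4) :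
    ∃ p, p % 4 = i % 4 ∧ InStrip Y.block p z := by
  have hpos := Y.block_pos z
  rw [Y.arm_mod_four] at h
  rcases h with h | h
  · exact ⟨Y.block z, h, Or.inl rfl⟩
  · exact ⟨Y.block z - 1, by omega, by omega⟩

theorem key_lt_of_strip_lt {p q : ℕ} {x y : V} (hpq : p < q) (hmod : p % 4 = q % 4)
    (hx : InStrip Y.block p x) (hy : InStrip Y.block q y) : Y.key p x < Y.key p y := by
  have hxa := Y.arm_mod_four x
  by_contra! hle
  obtain ⟨w, hw, hwy⟩ := Y.exists_mem_upper_key_le (i := p + 4) (y := y) (by omega)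
    (by rw [Y.mem_upper_iff, Y.mem_upper_iff]; omega)
  rw [Y.key_mod, Y.key_mod] at hwy
  have hxw := Y.mem_upper_of_key_le (y := x) hw (by omega)
    (by rw [Y.key_mod, Y.key_mod]; exact hwy.trans hle)
  rw [Y.mem_upper_iff, Y.mem_upper_iff] at hxw
  omega

variable {Y} in
theorem IsFirst.block_eq {i : ℕ} {z : V} (hi : 4 ≤ i) (h : Y.IsFirst i z) : Y.block z = i := by
  have hmem := Y.mem_upper_iff.1 h.1
  have hnotMem := mt Y.mem_upper_iff.2 (h.not_mem_upper_add_four hi)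
  omega

theorem isChain_of_next {p q : ℕ} {x y : V} (hpq : p < q) (hmod : p % 4 = q % 4)
    (hx : InStrip Y.block p x) (hy : InStrip Y.block q y)
    (hnext : ∀ w, (Y.arm w % 4 = p % 4 ∨ Y.arm w % 4 = (p + 1) % 4) → Y.key p x < Y.key p w →
      Y.key p y ≤ Y.key p w) : Y.IsChain y ∧ Y.block y = p + 4 := by
  have hya := Y.arm_mod_four y
  obtain ⟨u, hu, huy⟩ := Y.exists_mem_upper_key_le (i := p + 4) (y := y) (by omega)
    (by rw [Y.mem_upper_iff, Y.mem_upper_iff]; omega)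
  obtain ⟨w, hw⟩ := Y.exists_isFirst ⟨u, hu⟩
  have hwp : Y.block w = p + 4 := hw.block_eq (by omega)
  have hwa := Y.arm_mod_four w
  have hwy : Y.key p w ≤ Y.key p y := by
    simpa only [Y.key_mod] using (hw.2 u hu).trans huy
  have hyw : Y.key p y ≤ Y.key p w := hnext w (by omega)
    (Y.key_lt_of_strip_lt (q := p + 4) (by omega) (by omega) hx (Or.inl hwp))
  obtain rfl := Y.key_inj p w y (by omega) (by omega) (le_antisymm hwy hyw)
  exact ⟨by rwa [IsChain, hwp], hwp⟩

theorem inStrip_or_isChain_of_next {i : ℕ} {x y : V}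
    (hx : Y.arm x % 4 = i % 4 ∨ Y.arm x % 4 = (i + 1) % 4)
    (hy : Y.arm y % 4 = i % 4 ∨ Y.arm y % 4 = (i + 1) % 4) (hxy : Y.key i x < Y.key i y)
    (hnext : ∀ w, (Y.arm w % 4 = i % 4 ∨ Y.arm w % 4 = (i + 1) % 4) → Y.key i x < Y.key i w →
      Y.key i y ≤ Y.key i w) :
    (∃ p, p % 4 = i % 4 ∧ InStrip Y.block p x ∧ InStrip Y.block p y) ∨
      Y.IsChain y ∧ Y.block x ≤ Y.block y + 4 ∧ Y.block y ≤ Y.block x + 4 := by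
  obtain ⟨p, hp, hxp⟩ := Y.exists_inStrip hx
  obtain ⟨q, hq, hyq⟩ := Y.exists_inStrip hy
  have hkey := fun z => Y.key_congr hp z
  rcases lt_trichotomy p q with hpq | rfl | hqp
  · right
    have hchain := Y.isChain_of_next hpq (by omega) hxp hyq fun w hw hxw => by
      rw [hkey, hkey] at *
      exact hnext w (by omega) hxw
    exact ⟨hchain.1, by omega, by omega⟩
  · exact Or.inl ⟨p, hp, hxp, hyq⟩
  · have hyx := Y.key_lt_of_strip_lt hqp (by omega) hyq hxp
    rw [Y.key_congr hq, Y.key_congr hq] at hyx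
    omega

/-- The point `x` precedes `y` in the order by depth of a strip that contains both. -/
def Before (x y : V) : Prop :=
  ∃ i, InStrip Y.block i x ∧ InStrip Y.block i y ∧ Y.key i x < Y.key i y

theorem before_iff_key_lt {i : ℕ} {x y : V} (hx : InStrip Y.block i x)
    (hy : InStrip Y.block i y) : Y.Before x y ↔ Y.key i x < Y.key i y := by
  have hxa := Y.arm_mod_four x
  have hya := Y.arm_mod_four y
  refine ⟨fun ⟨j, hxj, hyj, hlt⟩ => ?_, fun h => ⟨i, hx, hy, h⟩⟩
  obtain rfl | rfl | rfl : j = i ∨ j = i + 1 ∨ i = j + 1 := by omega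
  · exact hlt
  · exact (Y.key_succ i x y (by omega) (by omega)).2 hlt
  · exact (Y.key_succ j x y (by omega) (by omega)).1 hlt

theorem exists_minimal_in_block (W : Set V) {v : V} (hv : v ∈ W) :
    ∃ z ∈ W, Y.block z = Y.block v ∧ ∀ w ∈ W, Y.block w = Y.block v → ¬ Y.Before w z := by
  obtain ⟨z, ⟨hz, hzv⟩, hmin⟩ := Set.exists_min_image {w ∈ W | Y.block w = Y.block v}
    (Y.key (Y.block v)) (Set.toFinite _) ⟨v, hv, rfl⟩
  refine ⟨z, hz, hzv, fun w hw hwv => ?_⟩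
  rw [Y.before_iff_key_lt (Or.inl hwv) (Or.inl hzv)]
  exact (hmin w ⟨hw, hwv⟩).not_gt

theorem wellFounded_before : WellFounded Y.Before := by
  refine WellFounded.wellFounded_iff_has_min.2 fun W ⟨v, hv⟩ => ?_
  let Q := {z ∈ W | ∀ w ∈ W, Y.block w ≤ Y.block z → ¬ Y.Before w z}
  have hQ : Q.Nonempty := by
    obtain ⟨u, hu, hlow⟩ := Set.exists_min_image W Y.block (Set.toFinite _) ⟨v, hv⟩
    obtain ⟨z, hz, hzu, hmin⟩ := Y.exists_minimal_in_block W hu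
    exact ⟨z, hz, fun w hw hle => hmin w hw (le_antisymm (hle.trans hzu.le) (hlow w hw))⟩
  obtain ⟨z, ⟨hzW, hz⟩, hmax⟩ := Set.exists_max_image Q Y.block (Set.toFinite _) hQ
  refine ⟨z, hzW, fun w hw hwz => ?_⟩
  have hwz_block : Y.block w = Y.block z + 1 := by
    have := mt (hz w hw) (not_not.2 hwz)
    obtain ⟨i, hwi, hzi, -⟩ := hwz
    omega
  obtain ⟨y, hy, hyw, hymin⟩ := Y.exists_minimal_in_block W hw
  suffices y ∈ Q by
    have := hmax y this
    omega
  refine ⟨hy, fun v hv hle hvy => ?_⟩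
  have hv_block : Y.block v = Y.block z := by
    have := mt (hymin v hv) (not_not.2 hvy)
    obtain ⟨i, hvi, hyi, -⟩ := hvy
    omega
  have hstrip : ∀ u, Y.block u = Y.block z ∨ Y.block u = Y.block w →
      InStrip Y.block (Y.block z) u := fun u hu => by omega
  rw [Y.before_iff_key_lt (hstrip v (by omega)) (hstrip y (by omega))] at hvy
  rw [Y.before_iff_key_lt (hstrip w (by omega)) (hstrip z (by omega))] at hwz
  have hwy := hymin w hw rfl
  rw [Y.before_iff_key_lt (hstrip w (by omega)) (hstrip y (by omega))] at hwy
  refine hz v hv hv_block.le ?_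
  rw [Y.before_iff_key_lt (hstrip v (by omega)) (hstrip z (by omega))]
  omega

end Finite

/-- The arms of `x` and `y` are both among two cyclically consecutive arms, in whose depth `y` is
one step deeper than `x`. -/
def IsStep (x y : V) : Prop :=
  ∃ i, (Y.arm x % 4 = i % 4 ∨ Y.arm x % 4 = (i + 1) % 4) ∧
    (Y.arm y % 4 = i % 4 ∨ Y.arm y % 4 = (i + 1) % 4) ∧ Y.key i y = Y.key i x + 1

/-- The times `τ` order the points of every strip by depth. -/
structure IsTime (τ : V → ℕ) : Prop where
  injective : Function.Injective τ
  lt_of_before : ∀ x y, Y.Before x y → τ x < τ y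

end SpiralSystem

theorem exists_injective_strictMono_of_wellFounded {V : Type*} [Finite V] {r : V → V → Prop}
    (hr : WellFounded r) : ∃ τ : V → ℕ, Function.Injective τ ∧ ∀ x y, r x y → τ x < τ y := by
  classical
  have : IsWellFounded V r := ⟨hr⟩
  obtain ⟨s, hrs, _⟩ := IsWellFounded.exists_well_order_ge r
  let := Fintype.ofFinite V
  let := linearOrderOfSTO s
  let e := (Fintype.orderIsoFinOfCardEq V rfl).symm
  exact ⟨fun x => e x, Fin.val_injective.comp e.injective,
    fun x y hxy => e.strictMono (hrs x y hxy)⟩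

namespace SpiralSystem

variable {V : Type*} [Finite V] (Y : SpiralSystem V)

theorem exists_isTime : ∃ τ, Y.IsTime τ := by
  obtain ⟨τ, hinj, hτ⟩ := exists_injective_strictMono_of_wellFounded Y.wellFounded_before
  exact ⟨τ, hinj, hτ⟩

variable {Y}

theorem IsTime.key_lt_iff {τ : V → ℕ} (hτ : Y.IsTime τ) {i : ℕ} {x y : V}
    (hx : InStrip Y.block i x) (hy : InStrip Y.block i y) :
    Y.key i x < Y.key i y ↔ τ x < τ y := by
  have hxa := Y.arm_mod_four x
  have hya := Y.arm_mod_four y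
  refine ⟨fun h => hτ.lt_of_before x y ⟨i, hx, hy, h⟩, fun h => ?_⟩
  by_contra! hle
  rcases hle.lt_or_eq with hlt | heq
  · exact h.not_gt (hτ.lt_of_before y x ⟨i, hy, hx, hlt⟩)
  · obtain rfl := Y.key_inj i y x (by omega) (by omega) heq
    exact h.false

theorem IsTime.consecutive_or_isChain {τ : V → ℕ} (hτ : Y.IsTime τ) {x y : V}
    (hstep : Y.IsStep x y) : (∃ t, Consecutive Y.block τ t x y) ∨
      Y.IsChain y ∧ Y.block x ≤ Y.block y + 4 ∧ Y.block y ≤ Y.block x + 4 := by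
  obtain ⟨i, hx, hy, hxy⟩ := hstep
  refine (Y.inStrip_or_isChain_of_next hx hy (by omega) fun w _ h => by omega).imp_left ?_
  rintro ⟨p, hp, hxp, hyp⟩
  have hkey := fun z => Y.key_congr hp z
  have hlt := fun {u v} hu hv => (hτ.key_lt_iff (i := p) (x := u) (y := v) hu hv).symm
  simp only [hkey] at hlt
  refine ⟨p, hxp, hyp, (hlt hxp hyp).2 (by omega), fun w hw hxw => not_lt.1 fun hwy => ?_⟩
  rw [hlt hxp hw] at hxw
  rw [hlt hw hyp] at hwy
  omega

end SpiralSystem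

/-! ### Waves and cuts of a strip system -/

section Strip

variable {V : Type*} {β τ : V → ℕ}

/-- The points of block `t` at height at least `h`, where a point has height at least `h + 1` if it
comes after points of height at least `h` in both neighbouring blocks. Only `h < t` is of interest,
so that the truncation of `t - 1` plays no role. -/
def wave (β τ : V → ℕ) : ℕ → ℕ → Set V
  | 0, t => {y | β y = t}
  | h + 1, t => {y | β y = t ∧ (∃ x ∈ wave β τ h (t - 1), τ x < τ y) ∧
      ∃ x ∈ wave β τ h (t + 1), τ x < τ y}

theorem block_of_mem_wave {h t : ℕ} {y : V} (hy : y ∈ wave β τ h t) : β y = t := by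
  cases h with
  | zero => exact hy
  | succ h => exact hy.1

theorem wave_succ_subset (h t : ℕ) : wave β τ (h + 1) t ⊆ wave β τ h t := by
  induction h generalizing t with
  | zero => exact fun y hy => hy.1
  | succ h ih =>
    rintro y ⟨hyt, ⟨x, hx, hxy⟩, x', hx', hxy'⟩
    exact ⟨hyt, ⟨x, ih _ hx, hxy⟩, x', ih _ hx', hxy'⟩

theorem wave_antitone (t : ℕ) : Antitone fun h => wave β τ h t :=
  antitone_nat_of_succ_le fun h => wave_succ_subset h t

/-- The point `y` is the first one of height at least `h` in block `t`. -/
def IsWaveMin (β τ : V → ℕ) (h t : ℕ) (y : V) : Prop :=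
  y ∈ wave β τ h t ∧ ∀ z ∈ wave β τ h t, τ y ≤ τ z

theorem exists_isWaveMin [Finite V] {h t : ℕ} (hne : (wave β τ h t).Nonempty) :
    ∃ y, IsWaveMin β τ h t y :=
  Set.exists_min_image _ τ (Set.toFinite _) hne

theorem exists_adjacent_isWaveMin [Finite V] {h t : ℕ} (ht : h < t)
    (hleft : (wave β τ h (t - 1)).Nonempty) (hright : (wave β τ h (t + 1)).Nonempty) :
    ∃ m t', h ≤ t' ∧ (t = t' + 1 ∨ t' = t + 1) ∧ IsWaveMin β τ h t' m ∧
      ∀ z, β z = t → (τ m < τ z ↔ z ∈ wave β τ (h + 1) t) := by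
  obtain ⟨m₁, hm₁⟩ := exists_isWaveMin hleft
  obtain ⟨m₂, hm₂⟩ := exists_isWaveMin hright
  have hwave : ∀ z, β z = t → (τ m₁ < τ z ∧ τ m₂ < τ z ↔ z ∈ wave β τ (h + 1) t) := by
    refine fun z hz => ⟨fun hlt => ⟨hz, ⟨m₁, hm₁.1, hlt.1⟩, m₂, hm₂.1, hlt.2⟩, ?_⟩
    rintro ⟨-, ⟨x₁, hx₁, hxz₁⟩, x₂, hx₂, hxz₂⟩
    exact ⟨(hm₁.2 x₁ hx₁).trans_lt hxz₁, (hm₂.2 x₂ hx₂).trans_lt hxz₂⟩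
  rcases le_total (τ m₁) (τ m₂) with hle | hle
  · refine ⟨m₂, t + 1, by omega, Or.inr rfl, hm₂, fun z hz => ?_⟩
    rw [← hwave z hz, and_iff_right_of_imp hle.trans_lt]
  · refine ⟨m₁, t - 1, by omega, Or.inl (by omega), hm₁, fun z hz => ?_⟩
    rw [← hwave z hz, and_iff_left_of_imp hle.trans_lt]

/-- The border of `S` stays within distance `h` of block `t`: all blocks further to the left lie in
`S`, and all blocks further to the right lie outside `S`. -/
structure BorderNear (β : V → ℕ) (t h : ℕ) (S : Set V) : Prop where
  mem_of_add_lt : ∀ z, β z + h < t → z ∈ S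
  le_add_of_mem : ∀ z ∈ S, β z ≤ t + h

theorem BorderNear.mono {t h t' h' : ℕ} {S : Set V} (hS : BorderNear β t h S)
    (hleft : t + h ≤ t' + h') (hright : t' + h ≤ t + h') : BorderNear β t' h' S where
  mem_of_add_lt z hz := hS.mem_of_add_lt z (by omega)
  le_add_of_mem z hz := (hS.le_add_of_mem z hz).trans hleft

/-- Up to time `p`, the set `A` cuts the left part `S` of the strips from the right part. At time
`p` the border of `S` is at block `t`: a strip that does not contain block `t` is in `S` at time `p`
if and only if it is to the left of block `t`. -/
structure IsCut (β τ : V → ℕ) (A S : Set V) (p t : ℕ) : Prop where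
  mem_iff_mem : ∀ u x y, Consecutive β τ u x y → y ∉ A → τ y < p → (x ∈ S ↔ y ∈ S)
  mem_iff_lt : ∀ u x y, Consecutive β τ u x y → y ∉ A → τ x < p → p ≤ τ y → u ≠ t → u + 1 ≠ t →
    (x ∈ S ↔ u < t)

theorem isCut_setOf_lt {p t : ℕ} (ht : ∀ z, β z = t → p ≤ τ z) :
    IsCut β τ ∅ {z | β z < t} p t where
  mem_iff_mem u x y hxy _ hyp := by
    have := mt (ht x) (hxy.lt.trans hyp).not_ge
    have := mt (ht y) hyp.not_ge
    have := hxy.left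
    have := hxy.right
    grind
  mem_iff_lt u x y hxy _ _ _ _ _ := by
    have := hxy.left
    grind

/-- The part of the strips to the left of a cut that follows `S` up to time `p` and runs between the
blocks `t` and `t'` from then on. -/
def extendCut (β τ : V → ℕ) (S : Set V) (p t t' : ℕ) : Set V :=
  {z | τ z < p ∧ z ∈ S ∨ p ≤ τ z ∧ β z < max t t'}

theorem BorderNear.extendCut {t h t' p : ℕ} {S : Set V} (hS : BorderNear β t h S)
    (htt' : t = t' + 1 ∨ t' = t + 1) : BorderNear β t' (h + 1) (extendCut β τ S p t t') where
  mem_of_add_lt z hz := by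
    rcases lt_or_ge (τ z) p with hzp | hzp
    · exact Or.inl ⟨hzp, hS.mem_of_add_lt z (by omega)⟩
    · exact Or.inr ⟨hzp, by omega⟩
  le_add_of_mem z hz := by
    rcases hz with ⟨-, hz⟩ | ⟨-, hz⟩
    · have := hS.le_add_of_mem z hz
      omega
    · omega

theorem mem_extendCut_of_lt {S : Set V} {p t t' : ℕ} {z : V} (hz : τ z < p) :
    z ∈ extendCut β τ S p t t' ↔ z ∈ S := by
  simp [extendCut, hz, hz.not_ge]

theorem mem_extendCut_of_le {S : Set V} {p t t' : ℕ} {z : V} (hz : p ≤ τ z) :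
    z ∈ extendCut β τ S p t t' ↔ β z < max t t' := by
  simp [extendCut, hz, hz.not_gt]

theorem IsCut.mem_iff_lt_of_crossing (hτ : Function.Injective τ) {A S : Set V} {m : V} {t : ℕ}
    (hS : IsCut β τ A S (τ m) t) (hm : β m = t) {u : ℕ} {x y : V} (hxy : Consecutive β τ u x y)
    (hy : y ∉ insert m A) (hxm : τ x < τ m) (hmy : τ m ≤ τ y) :
    u ≠ t ∧ u + 1 ≠ t ∧ (x ∈ S ↔ u < t) := by
  have hne : τ m ≠ τ y := fun heq => hy (Set.mem_insert_iff.2 (Or.inl (hτ heq).symm))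
  have hut : ¬ (t = u ∨ t = u + 1) := fun hut =>
    (hxy.le_of_lt m (by omega) hxm).not_gt (hmy.lt_of_ne hne)
  exact ⟨by omega, by omega, hS.mem_iff_lt u x y hxy
    (fun hyA => hy (Set.mem_insert_of_mem m hyA)) hxm hmy (by omega) (by omega)⟩

theorem IsCut.extendCut (hτ : Function.Injective τ) {A S : Set V} {m : V} {p' t t' : ℕ}
    (hS : IsCut β τ A S (τ m) t) (hm : β m = t) (htt' : t = t' + 1 ∨ t' = t + 1)
    (hp : τ m < p') (hgap : ∀ z, β z = t' → τ m < τ z → p' ≤ τ z) :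
    IsCut β τ (insert m A) (extendCut β τ S (τ m) t t') p' t' := by
  have not_between : ∀ z, τ m ≤ τ z → τ z < p' → β z ≠ t' := by
    intro z hmz hzp hz
    rcases hmz.lt_or_eq with hlt | heq
    · exact hzp.not_ge (hgap z hz hlt)
    · obtain rfl := hτ heq
      omega
  constructor
  · intro u x y hxy hy hyp
    have hx1 := hxy.left
    have hy1 := hxy.right
    rcases lt_or_ge (τ y) (τ m) with hym | hmy
    · rw [mem_extendCut_of_lt (hxy.lt.trans hym), mem_extendCut_of_lt hym]
      exact hS.mem_iff_mem u x y hxy (fun hyA => hy (Set.mem_insert_of_mem m hyA)) hym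
    have hyt := not_between y hmy hyp
    rw [mem_extendCut_of_le hmy]
    rcases lt_or_ge (τ x) (τ m) with hxm | hmx
    · rw [mem_extendCut_of_lt hxm]
      obtain ⟨hut, hut', hmem⟩ := hS.mem_iff_lt_of_crossing hτ hm hxy hy hxm hmy
      rw [hmem]
      omega
    · rw [mem_extendCut_of_le hmx]
      have := not_between x hmx (hxy.lt.trans hyp)
      omega
  · intro u x y hxy hy _ hyp hu hu'
    have hx1 := hxy.left
    rcases lt_or_ge (τ x) (τ m) with hxm | hmx
    · rw [mem_extendCut_of_lt hxm]
      obtain ⟨hut, hut', hmem⟩ := hS.mem_iff_lt_of_crossing hτ hm hxy hy hxm (hp.le.trans hyp)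
      rw [hmem]
      omega
    · rw [mem_extendCut_of_le hmx]
      omega

theorem exists_isCut_of_isWaveMin [Finite V] (hτ : Function.Injective τ) {h t : ℕ} {y : V}
    (ht : h ≤ t) (hy : IsWaveMin β τ h t y) :
    ∃ (A : Finset V) (S : Set V), A.card ≤ h ∧ IsCut β τ A S (τ y) t ∧ BorderNear β t h S := by
  classical
  induction h generalizing t y with
  | zero =>
    exact ⟨∅, {z | β z < t}, le_rfl, by simpa using isCut_setOf_lt hy.2,
      fun z hz => hz, fun z hz => hz.le⟩
  | succ h ih =>
    obtain ⟨-, ⟨x₁, hx₁, -⟩, x₂, hx₂, -⟩ := hy.1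
    obtain ⟨m, t', ht', htt', hm, hwave⟩ := exists_adjacent_isWaveMin ht ⟨x₁, hx₁⟩ ⟨x₂, hx₂⟩
    obtain ⟨A, S, hA, hcut, hborder⟩ := ih ht' hm
    refine ⟨insert m A, extendCut β τ S (τ m) t' t, (Finset.card_insert_le m A).trans (by omega),
      ?_, hborder.extendCut htt'.symm⟩
    rw [Finset.coe_insert]
    exact hcut.extendCut hτ (block_of_mem_wave hm.1) htt'.symm
      ((hwave y (block_of_mem_wave hy.1)).2 hy.1) fun z hz hmz => hy.2 z ((hwave z hz).1 hmz)

theorem exists_cut_of_wave_eq_empty [Finite V] (hτ : Function.Injective τ) {h t : ℕ} (ht : h < t)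
    (hempty : wave β τ h t = ∅) :
    ∃ (A : Finset V) (S : Set V), A.card ≤ h ∧ BorderNear β t h S ∧
      ∀ u x y, Consecutive β τ u x y → y ∉ A → (x ∈ S ↔ y ∈ S) := by
  classical
  obtain ⟨N, hN⟩ : ∃ N, ∀ z, τ z < N := by
    obtain ⟨N, hN⟩ := (Set.finite_range τ).bddAbove
    exact ⟨N + 1, fun z => Nat.lt_succ_of_le (hN ⟨z, rfl⟩)⟩
  induction h generalizing t with
  | zero =>
    have hcut : IsCut β τ ∅ {z | β z < t} N t :=
      isCut_setOf_lt fun z hz => (Set.eq_empty_iff_forall_notMem.1 hempty z hz).elim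
    exact ⟨∅, {z | β z < t}, le_rfl, ⟨fun z hz => hz, fun z hz => hz.le⟩,
      fun u x y hxy _ => hcut.mem_iff_mem u x y hxy (Set.notMem_empty y) (hN y)⟩
  | succ h ih =>
    rcases Set.eq_empty_or_nonempty (wave β τ h (t - 1)) with hleft | hleft
    · obtain ⟨A, S, hA, hborder, hcut⟩ := ih (by omega) hleft
      exact ⟨A, S, by omega, hborder.mono (by omega) (by omega), hcut⟩
    rcases Set.eq_empty_or_nonempty (wave β τ h (t + 1)) with hright | hright
    · obtain ⟨A, S, hA, hborder, hcut⟩ := ih (by omega) hright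
      exact ⟨A, S, by omega, hborder.mono (by omega) (by omega), hcut⟩
    obtain ⟨m, t', ht', htt', hm, hwave⟩ := exists_adjacent_isWaveMin (by omega) hleft hright
    obtain ⟨A, S, hA, hcut, hborder⟩ := exists_isCut_of_isWaveMin hτ ht' hm
    have hcut' := hcut.extendCut hτ (block_of_mem_wave hm.1) htt'.symm (hN m) fun z hz hmz =>
      (Set.eq_empty_iff_forall_notMem.1 hempty z ((hwave z hz).1 hmz)).elim
    refine ⟨insert m A, _, (Finset.card_insert_le m A).trans (by omega),
      hborder.extendCut htt'.symm, fun u x y hxy hy => hcut'.mem_iff_mem u x y hxy ?_ (hN y)⟩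
    rwa [← Finset.coe_insert]

end Strip

/-! ### Walls force high waves -/

/-- Apart from a set `Z` of at most two vertices, the edges of `G` join consecutive points of a
strip, or one of their ends belongs to a set `chain` with at most one point in each block and the
other end is at most four blocks away. -/
structure IsStripGraph {V : Type*} (G : SimpleGraph V) (β τ : V → ℕ) (chain : Set V)
    (Z : Finset V) : Prop where
  time_injective : Function.Injective τ
  card_le : Z.card ≤ 2
  chain_injOn : Set.InjOn β chain
  adj : ∀ x y, x ∉ Z → y ∉ Z → G.Adj x y →
    (∃ t, Consecutive β τ t x y ∨ Consecutive β τ t y x) ∨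
    ((x ∈ chain ∨ y ∈ chain) ∧ β x ≤ β y + 4 ∧ β y ≤ β x + 4)

namespace IsStripGraph

variable {V : Type*} [Finite V] {G : SimpleGraph V} {β τ : V → ℕ} {chain : Set V} {Z : Finset V}

theorem exists_chain_window (h : IsStripGraph G β τ chain Z) (lo hi : ℕ) :
    ∃ B : Finset V, B.card ≤ hi + 1 - lo ∧ ∀ x ∈ chain, lo ≤ β x → β x ≤ hi → x ∈ B := by
  classical
  have := Fintype.ofFinite V
  refine ⟨Finset.univ.filter fun x => x ∈ chain ∧ lo ≤ β x ∧ β x ≤ hi, ?_,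
    fun x hx hlo hhi => by simp [hx, hlo, hhi]⟩
  rw [← Nat.card_Icc]
  refine Finset.card_le_card_of_injOn β (fun x hx => ?_) (h.chain_injOn.mono fun x hx => ?_)
  · simp only [Finset.coe_filter, Set.mem_ofPred_eq] at hx
    simpa using hx.2.2
  · simp only [Finset.coe_filter, Set.mem_ofPred_eq] at hx
    exact hx.2.1

theorem exists_separates_of_wave_eq_empty (h : IsStripGraph G β τ chain Z) {k t : ℕ} (hkt : k < t)
    (hempty : wave β τ k t = ∅) :
    ∃ (X : Finset V) (S : Set V), X.card ≤ 3 * k + 11 ∧ Separates G X S ∧ BorderNear β t k S := by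
  classical
  obtain ⟨A, S, hA, hborder, hcut⟩ := exists_cut_of_wave_eq_empty h.time_injective hkt hempty
  obtain ⟨B, hBcard, hB⟩ := h.exists_chain_window (t - k - 4) (t + k + 4)
  refine ⟨A ∪ B ∪ Z, S, ?_, fun x y hx hy hxy hxS => ?_, hborder⟩
  · have := Finset.card_union_le (A ∪ B) Z
    have := Finset.card_union_le A B
    have := h.card_le
    omega
  · simp only [Finset.coe_union, Set.mem_union, Finset.mem_coe, not_or] at hx hy
    rcases h.adj x y hx.2 hy.2 hxy with ⟨u, hu | hu⟩ | ⟨hchain, hle, hle'⟩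
    · exact (hcut u x y hu hy.1.1).1 hxS
    · exact (hcut u y x hu hx.1.1).2 hxS
    · have hxhi := hborder.le_add_of_mem x hxS
      refine hborder.mem_of_add_lt y ?_
      rcases hchain with hchain | hchain
      · have := mt (hB x hchain · (by omega)) hx.1.2
        omega
      · have := mt (hB y hchain · (by omega)) hy.1.2
        omega

theorem exists_tops (h : IsStripGraph G β τ chain Z) (lo hi p : ℕ) :
    ∃ A : Finset V, A.card ≤ hi + 2 - lo ∧ ∀ t x y, Consecutive β τ t x y → lo ≤ β x → β x ≤ hi →
      τ x < p → p ≤ τ y → x ∈ A := by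
  classical
  have := Fintype.ofFinite V
  refine ⟨(Finset.Icc (lo - 1) hi).biUnion fun t => Finset.univ.filter fun x =>
    InStrip β t x ∧ τ x < p ∧ ∀ w, InStrip β t w → τ x < τ w → p ≤ τ w, ?_, ?_⟩
  · have hcard := Finset.card_biUnion_le_card_mul (Finset.Icc (lo - 1) hi)
      (fun t => Finset.univ.filter fun x =>
        InStrip β t x ∧ τ x < p ∧ ∀ w, InStrip β t w → τ x < τ w → p ≤ τ w) 1 fun t _ => by
      simp only [Finset.card_le_one, Finset.mem_filter, Finset.mem_univ, true_and]
      rintro x ⟨hx, hxp, hxlast⟩ y ⟨hy, hyp, hylast⟩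
      refine h.time_injective (le_antisymm ?_ ?_)
      · exact not_lt.1 fun hlt => (hylast x hx hlt).not_gt hxp
      · exact not_lt.1 fun hlt => (hxlast y hy hlt).not_gt hyp
    rw [Nat.card_Icc] at hcard
    omega
  · intro t x y hxy hlo hhi hxp hpy
    have := hxy.left
    simp only [Finset.mem_biUnion, Finset.mem_Icc, Finset.mem_filter, Finset.mem_univ, true_and]
    exact ⟨t, by omega, hxy.left, hxp, fun w hw hxw => hpy.trans (hxy.le_of_lt w hw hxw)⟩

theorem exists_separates_diff_before (h : IsStripGraph G β τ chain Z) {X X' : Finset V}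
    {S S' : Set V} {lo hi : ℕ} (hX : Separates G X S) (hX' : Separates G X' S')
    (hblock : ∀ z ∈ S' \ S, lo ≤ β z ∧ β z ≤ hi) (hle : lo ≤ hi) (p : ℕ) :
    ∃ D : Finset V, D.card ≤ X.card + X'.card + 2 * (hi - lo) + 5 ∧
      Separates G D {z ∈ S' \ S | τ z < p} := by
  classical
  obtain ⟨A, hAcard, hA⟩ := h.exists_tops lo hi p
  obtain ⟨B, hBcard, hB⟩ := h.exists_chain_window lo hi
  refine ⟨X ∪ X' ∪ Z ∪ B ∪ A, ?_, fun x y hx hy hxy ⟨hxdiff, hxp⟩ => ?_⟩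
  · have := Finset.card_union_le (X ∪ X' ∪ Z ∪ B) A
    have := Finset.card_union_le (X ∪ X' ∪ Z) B
    have := Finset.card_union_le (X ∪ X') Z
    have := Finset.card_union_le X X'
    have := h.card_le
    omega
  simp only [Finset.coe_union, Set.mem_union, Finset.mem_coe, not_or] at hx hy
  obtain ⟨⟨⟨⟨hxX, hxX'⟩, hxZ⟩, hxB⟩, hxA⟩ := hx
  obtain ⟨⟨⟨⟨hyX, hyX'⟩, hyZ⟩, hyB⟩, _⟩ := hy
  have hydiff : y ∈ S' \ S :=
    ⟨hX' hxX' hyX' hxy hxdiff.1, fun hyS => hxdiff.2 (hX hyX hxX hxy.symm hyS)⟩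
  have hxblock := hblock x hxdiff
  have hyblock := hblock y hydiff
  refine ⟨hydiff, not_le.1 fun hyp => ?_⟩
  rcases h.adj x y hxZ hyZ hxy with ⟨t, ht | ht⟩ | ⟨hchain | hchain, -⟩
  · exact hxA (hA t x y ht hxblock.1 hxblock.2 hxp hyp)
  · exact (ht.lt.trans hxp).not_ge hyp
  · exact hxB (hB x hchain hxblock.1 hxblock.2)
  · exact hyB (hB y hchain hyblock.1 hyblock.2)

-- If the mesh lay between the two separations, sweeping over the times would move it across a
-- separator of bounded size in one step, although each step adds at most one vertex.
theorem liesIn_of_liesIn (h : IsStripGraph G β τ chain Z) {m : ℕ} {R C : Fin m → Set V}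
    (hm : IsMesh G R C) {X X' : Finset V} {S S' : Set V} {lo hi : ℕ} (hX : Separates G X S)
    (hX' : Separates G X' S') (hblock : ∀ z ∈ S' \ S, lo ≤ β z ∧ β z ≤ hi) (hle : lo ≤ hi)
    (hcard : 2 * (X.card + X'.card + 2 * (hi - lo) + 5) + 1 < m) (hin : LiesIn R X' S') :
    LiesIn R X S := by
  classical
  have := Fintype.ofFinite V
  choose D hDcard hD using h.exists_separates_diff_before hX hX' hblock hle
  by_contra hout
  suffices ∀ p, ¬ LiesIn R (D p) {z ∈ S' \ S | τ z < p} by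
    obtain ⟨N, hN⟩ := (Set.finite_range τ).bddAbove
    obtain ⟨i, hiD, hi⟩ := hm.exists_row_subset_diff hX hX' hout hin (D (N + 1)) (by
      have := Finset.card_union_le (X ∪ X') (D (N + 1))
      have := Finset.card_union_le X X'
      have := hDcard (N + 1)
      omega)
    exact this (N + 1) ⟨i, hiD, fun x hx => ⟨hi hx, Nat.lt_succ_of_le (hN ⟨x, rfl⟩)⟩⟩
  intro p
  induction p with
  | zero => simpa using hm.not_liesIn_empty _
  | succ p ih =>
    have hone : (Finset.univ.filter fun z => τ z = p).card ≤ 1 :=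
      Finset.card_le_one.2 fun x hx y hy => h.time_injective <| by
        rw [(Finset.mem_filter.1 hx).2, (Finset.mem_filter.1 hy).2]
    refine fun hstep => ih (hm.liesIn_of_diff_subset (F := Finset.univ.filter fun z => τ z = p)
      (hD p) (hD (p + 1)) hstep ?_ ?_)
    · have := Finset.card_union_le (D p ∪ D (p + 1)) (Finset.univ.filter fun z => τ z = p)
      have := Finset.card_union_le (D p) (D (p + 1))
      have := hDcard p
      have := hDcard (p + 1)
      omega
    · rintro z ⟨⟨hz, hzp⟩, hznot⟩
      have : ¬ τ z < p := fun hlt => hznot ⟨hz, hlt⟩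
      simp only [Finset.coe_filter, Finset.mem_univ, true_and, Set.mem_ofPred_eq]
      omega

theorem exists_wave_nonempty (h : IsStripGraph G β τ chain Z) {m k : ℕ} {R C : Fin m → Set V}
    (hm : IsMesh G R C) (hmk : 68 * k + 64 ≤ m) :
    ∃ s, Even s ∧ ∀ i, s < i → i ≤ s + k → (wave β τ (3 * k) i).Nonempty := by
  by_contra! hempty
  have hsep : ∀ q, ∃ (X : Finset V) (S : Set V), X.card ≤ 9 * k + 11 ∧ Separates G X S ∧
      BorderNear β (2 * q) (4 * k) S := fun q => by
    obtain ⟨i, hqi, hiq, hi⟩ := hempty (2 * q) (even_two_mul q)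
    rcases le_or_gt i (3 * k) with hik | hki
    · exact ⟨∅, ∅, by simp, fun x y _ _ _ hx => hx, fun z hz => by omega, fun z hz => hz.elim⟩
    · obtain ⟨X, S, hX, hS, hborder⟩ := h.exists_separates_of_wave_eq_empty hki hi
      exact ⟨X, S, by omega, hS, hborder.mono (by omega) (by omega)⟩
  choose X S hXcard hX hS using hsep
  suffices ∀ q, ¬ LiesIn R (X q) (S q) by
    obtain ⟨N, hN⟩ := (Set.finite_range β).bddAbove
    obtain ⟨i, hi⟩ := hm.exists_row_disjoint (X := X (N + 4 * k + 1))
      (by have := hXcard (N + 4 * k + 1); omega)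
    refine this _ ⟨i, hi, fun x _ => (hS _).mem_of_add_lt x ?_⟩
    have : β x ≤ N := hN ⟨x, rfl⟩
    omega
  intro q hin
  induction q with
  | zero =>
    refine hm.not_liesIn_empty _ (h.liesIn_of_liesIn hm (X := ∅) (S := ∅) (lo := 0) (hi := 4 * k)
      (fun x y _ _ _ hx => hx) (hX 0) (fun z hz => ?_) (by omega) ?_ hin)
    · have := (hS 0).le_add_of_mem z hz.1
      omega
    · have := hXcard 0
      rw [Finset.card_empty]
      omega
  | succ q ih =>
    refine ih (h.liesIn_of_liesIn hm (lo := 2 * q - 4 * k) (hi := 2 * (q + 1) + 4 * k) (hX q)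
      (hX (q + 1)) (fun z hz => ?_) (by omega) ?_ hin)
    · have := (hS (q + 1)).le_add_of_mem z hz.1
      have := mt ((hS q).mem_of_add_lt z) hz.2
      omega
    · have := hXcard q
      have := hXcard (q + 1)
      omega

end IsStripGraph

/-- The points `a i j` form a `k`-track in the strips of the blocks `s, …, s + k - 1`: the point
`a i j` is the `j`th point of block `s + i`, and two consecutive blocks alternate in time. -/
structure IsTrackGrid {V : Type*} (β τ : V → ℕ) (s k : ℕ) (a : ℕ → ℕ → V) : Prop where
  block : ∀ i < k, ∀ j < k, β (a i j) = s + i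
  right : ∀ i j, i + 1 < k → j < k → τ (a i j) < τ (a (i + 1) j)
  up : ∀ i j, i + 1 < k → j + 1 < k → τ (a (i + 1) j) < τ (a i (j + 1))
  same : ∀ i j, i < k → j + 1 < k → τ (a i j) < τ (a i (j + 1))

-- The point `a i j` is the first one of height at least `i + 2 * j` in its block.
theorem exists_isTrackGrid {V : Type*} [Finite V] {β τ : V → ℕ} {s k : ℕ} (hk : 0 < k)
    (hw : ∀ i, s ≤ i → i < s + k → (wave β τ (3 * k) i).Nonempty) :
    ∃ a, IsTrackGrid β τ s k a := by
  have : Nonempty V := (hw s le_rfl (by omega)).to_subtype.map Subtype.val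
  have hmin : ∀ i j, ∃ y, i < k → j < k → IsWaveMin β τ (i + 2 * j) (s + i) y := fun i j => by
    by_cases hij : i < k ∧ j < k
    · obtain ⟨y, hy⟩ := exists_isWaveMin ((hw (s + i) (by omega) (by omega)).mono
        (wave_antitone (s + i) (by omega : i + 2 * j ≤ 3 * k)))
      exact ⟨y, fun _ _ => hy⟩
    · exact ⟨Classical.arbitrary V, fun hi hj => absurd ⟨hi, hj⟩ hij⟩
  choose a ha using hmin
  refine ⟨a, fun i hi j hj => block_of_mem_wave (ha i j hi hj).1, ?_, ?_, ?_⟩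
  · intro i j hi hj
    have hmem := (ha (i + 1) j hi hj).1
    rw [show i + 1 + 2 * j = (i + 2 * j) + 1 by ring] at hmem
    obtain ⟨-, ⟨x, hx, hxy⟩, -⟩ := hmem
    exact ((ha i j (by omega) hj).2 x hx).trans_lt hxy
  · intro i j hi hj
    have hmem := (ha i (j + 1) (by omega) hj).1
    rw [show i + 2 * (j + 1) = (i + 1 + 2 * j) + 1 by ring] at hmem
    obtain ⟨-, -, x, hx, hxy⟩ := hmem
    exact ((ha (i + 1) j hi (by omega)).2 x hx).trans_lt hxy
  · intro i j hi hj
    obtain ⟨-, -, x, hx, hxy⟩ := (ha i (j + 1) hi hj).1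
    obtain ⟨-, ⟨w, hw, hwx⟩, -⟩ := hx
    exact (((ha i j hi (by omega)).2 w hw).trans_lt hwx).trans hxy

/-! ### The center of a skew-merged permutation -/

section Patterns

variable {n : ℕ} {π : Equiv.Perm (Fin n)}

theorem contains_of_strictMono {k : ℕ} {σ : Equiv.Perm (Fin k)} {f : Fin k → Fin n}
    (hf : StrictMono f) (h : ∀ a b, σ a < σ b → π (f a) < π (f b)) : Contains π σ := by
  refine ⟨f, hf, fun a b => ⟨fun hab => not_le.1 fun hba => ?_, h a b⟩⟩
  rcases hba.lt_or_eq with hlt | heq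
  · exact lt_asymm hab (h b a hlt)
  · exact hab.ne (by rw [σ.injective heq])

theorem strictMono_vec4 {α : Type*} [Preorder α] {a b c d : α} (hab : a < b) (hbc : b < c)
    (hcd : c < d) : StrictMono ![a, b, c, d] := by
  rw [Fin.strictMono_iff_lt_succ]
  intro i
  fin_cases i
  exacts [hab, hbc, hcd]

theorem contains_p2143 {a b c d : Fin n} (hab : a < b) (hbc : b < c) (hcd : c < d)
    (hba : π b < π a) (had : π a < π d) (hdc : π d < π c) : Contains π p2143 := by
  refine contains_of_strictMono (strictMono_vec4 hab hbc hcd) fun i j => ?_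
  fin_cases i <;> fin_cases j <;> simp [p2143] <;> omega

theorem contains_p3412 {a b c d : Fin n} (hab : a < b) (hbc : b < c) (hcd : c < d)
    (hcd' : π c < π d) (hda : π d < π a) (hab' : π a < π b) : Contains π p3412 := by
  refine contains_of_strictMono (strictMono_vec4 hab hbc hcd) fun i j => ?_
  fin_cases i <;> fin_cases j <;> simp [p3412] <;> omega

theorem contains_p3142 {a b c d : Fin n} (hab : a < b) (hbc : b < c) (hcd : c < d)
    (hbd : π b < π d) (hda : π d < π a) (hac : π a < π c) : Contains π p3142 := by
  refine contains_of_strictMono (strictMono_vec4 hab hbc hcd) fun i j => ?_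
  fin_cases i <;> fin_cases j <;> simp [p3142] <;> omega

end Patterns

/-- The elements at the positions `i < j` form an ascent of `π`. -/
structure IsAscent {n : ℕ} (π : Equiv.Perm (Fin n)) (i j : Fin n) : Prop where
  pos : i < j
  val : π i < π j

/-- The elements at the positions `i < j` form a descent of `π`. -/
structure IsDescent {n : ℕ} (π : Equiv.Perm (Fin n)) (i j : Fin n) : Prop where
  pos : i < j
  val : π j < π i

/-- The lines before position `L` and below value `M` divide the elements into two increasing
sequences (below left and above right) and two decreasing ones: a pair of elements on the same side
of the vertical line that violates the monotonicity is forbidden in the respective quadrant. -/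
structure IsCenter {n : ℕ} (π : Equiv.Perm (Fin n)) (L M : ℕ) : Prop where
  ascent_left : ∀ i j, IsAscent π i j → (j : ℕ) < L → (π i : ℕ) < M
  descent_left : ∀ i j, IsDescent π i j → (j : ℕ) < L → M ≤ (π i : ℕ)
  ascent_right : ∀ i j, IsAscent π i j → L ≤ (i : ℕ) → M ≤ (π j : ℕ)
  descent_right : ∀ i j, IsDescent π i j → L ≤ (i : ℕ) → (π j : ℕ) < M

section Center

variable {n : ℕ} {π : Equiv.Perm (Fin n)} {L : ℕ}

theorem IsDescent.bottom_lt_top (h2143 : ¬ Contains π p2143) {a b c d : Fin n}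
    (hab : IsDescent π a b) (hcd : IsDescent π c d) (hbc : b < c) : π d < π a := by
  have hpos := hab.pos
  have hpos' := hcd.pos
  refine (not_le.1 fun hle => h2143 (contains_p2143 hpos hbc hpos' hab.val
    (hle.lt_of_ne fun heq => ?_) hcd.val))
  have := π.injective heq
  omega

theorem IsAscent.bottom_lt_top (h3412 : ¬ Contains π p3412) {a b c d : Fin n}
    (hab : IsAscent π a b) (hcd : IsAscent π c d) (hbc : b < c) : π a < π d := by
  have hpos := hab.pos
  have hpos' := hcd.pos
  refine (not_le.1 fun hle => h3412 (contains_p3412 hpos hbc hpos' hcd.val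
    (hle.lt_of_ne fun heq => ?_) hab.val))
  have := π.injective heq
  omega

/-- Among the positions before `L`, the lower element of every ascent is below the upper element
of every descent. -/
def IsSeparableBefore (π : Equiv.Perm (Fin n)) (L : ℕ) : Prop :=
  ∀ a b c d, IsAscent π a b → (b : ℕ) < L → IsDescent π c d → (d : ℕ) < L → π a < π c

theorem exists_maximal_isSeparableBefore (π : Equiv.Perm (Fin n)) :
    ∃ L, IsSeparableBefore π L ∧ (L < n → ¬ IsSeparableBefore π (L + 1)) := by
  classical
  refine ⟨Nat.findGreatest (IsSeparableBefore π) n,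
    Nat.findGreatest_spec (Nat.zero_le n) fun a b c d _ hb => absurd hb (Nat.not_lt_zero b),
    Nat.findGreatest_is_greatest (Nat.lt_succ_self _)⟩

-- The violation before `L + 1` involves an ascent and a descent, of which one is compatible with
-- the given descent and the other one with the given ascent.
theorem descent_bottom_lt_ascent_top (h2143 : ¬ Contains π p2143) (h3412 : ¬ Contains π p3412)
    (hL : L < n → ¬ IsSeparableBefore π (L + 1)) {a b c d : Fin n} (hab : IsDescent π a b)
    (ha : L ≤ (a : ℕ)) (hcd : IsAscent π c d) (hc : L ≤ (c : ℕ)) : π b < π d := by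
  have hviolation := hL (by omega)
  simp only [IsSeparableBefore, not_forall, not_lt] at hviolation
  obtain ⟨a', b', c', d', hab', hb', hcd', hd', hle⟩ := hviolation
  have hpos := hab.pos
  have hpos' := hcd.pos
  have hdescent : π b ≤ π c' := by
    rcases eq_or_ne d' a with rfl | hne
    · exact (hab.val.trans hcd'.val).le
    · exact (hcd'.bottom_lt_top h2143 hab (by omega)).le
  have hascent : π a' ≤ π d := by
    rcases eq_or_ne b' c with rfl | hne
    · exact (hab'.val.trans hcd.val).le
    · exact (hab'.bottom_lt_top h3412 hcd (by omega)).le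
  refine lt_of_le_of_ne (hdescent.trans (hle.trans hascent)) fun heq => ?_
  have := hab'.pos
  have := π.injective (show π a' = π b by omega)
  omega

theorem exists_separating_of_lt {A B : Set ℕ} (hA : BddAbove A) (h : ∀ a ∈ A, ∀ b ∈ B, a < b) :
    ∃ M, (∀ a ∈ A, a < M) ∧ ∀ b ∈ B, M ≤ b := by
  obtain ⟨N, hN⟩ := hA
  rcases B.eq_empty_or_nonempty with rfl | hB
  · exact ⟨N + 1, fun a ha => Nat.lt_succ_of_le (hN ha), fun b hb => hb.elim⟩
  · exact ⟨sInf B, fun a ha => h a ha _ (Nat.sInf_mem hB), fun b hb => Nat.sInf_le hb⟩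

theorem exists_isCenter (h2143 : ¬ Contains π p2143) (h3412 : ¬ Contains π p3412) :
    ∃ L M, IsCenter π L M := by
  obtain ⟨L, hL, hmax⟩ := exists_maximal_isSeparableBefore π
  let low : Set ℕ := {v | ∃ i j, v = π i ∧ IsAscent π i j ∧ (j : ℕ) < L} ∪
    {v | ∃ i j, v = π j ∧ IsDescent π i j ∧ L ≤ (i : ℕ)}
  let high : Set ℕ := {v | ∃ i j, v = π i ∧ IsDescent π i j ∧ (j : ℕ) < L} ∪
    {v | ∃ i j, v = π j ∧ IsAscent π i j ∧ L ≤ (i : ℕ)}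
  have hbdd : BddAbove low := by
    refine ⟨n, ?_⟩
    rintro _ (⟨i, j, rfl, -⟩ | ⟨i, j, rfl, -⟩)
    exacts [(π i).2.le, (π j).2.le]
  have hlt : ∀ u ∈ low, ∀ v ∈ high, u < v := by
    rintro _ (⟨a, b, rfl, hab, hb⟩ | ⟨a, b, rfl, hab, ha⟩) _
      (⟨c, d, rfl, hcd, hd⟩ | ⟨c, d, rfl, hcd, hc⟩)
    · exact hL a b c d hab hb hcd hd
    · exact hab.bottom_lt_top h3412 hcd (by omega)
    · exact hcd.bottom_lt_top h2143 hab (by omega)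
    · exact descent_bottom_lt_ascent_top h2143 h3412 hmax hab ha hcd hc
  obtain ⟨M, hlow, hhigh⟩ := exists_separating_of_lt hbdd hlt
  exact ⟨L, M, fun i j hij hj => hlow _ (Or.inl ⟨i, j, rfl, hij, hj⟩),
    fun i j hij hj => hhigh _ (Or.inl ⟨i, j, rfl, hij, hj⟩),
    fun i j hij hi => hhigh _ (Or.inr ⟨i, j, rfl, hij, hi⟩),
    fun i j hij hi => hlow _ (Or.inr ⟨i, j, rfl, hij, hi⟩)⟩

end Center

section CenterSystem

variable {n : ℕ} {π : Equiv.Perm (Fin n)} {L M : ℕ}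

/-- The arms around a center, counterclockwise: `1` above left, `2` below left, `3` below right and
`0` above right. The points are the values of `π`, as in `permGraph`. -/
def centerArm (π : Equiv.Perm (Fin n)) (L M : ℕ) (z : Fin n) : ℕ :=
  if (π.symm z : ℕ) < L then (if (z : ℕ) < M then 2 else 1) else (if (z : ℕ) < M then 3 else 0)

/-- The depth towards a center in the rows (for even `i`) or in the columns (for odd `i`). -/
def centerKey (π : Equiv.Perm (Fin n)) (L M i : ℕ) (z : Fin n) : ℕ :=
  if i % 2 = 1 then (if (π.symm z : ℕ) < L then (π.symm z : ℕ) else n - (π.symm z : ℕ))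
  else (if (z : ℕ) < M then (z : ℕ) else n - z)

theorem centerArm_cases (π : Equiv.Perm (Fin n)) (L M : ℕ) (z : Fin n) :
    ((π.symm z : ℕ) < L ∧ M ≤ (z : ℕ) ∧ centerArm π L M z = 1) ∨
    ((π.symm z : ℕ) < L ∧ (z : ℕ) < M ∧ centerArm π L M z = 2) ∨
    (L ≤ (π.symm z : ℕ) ∧ (z : ℕ) < M ∧ centerArm π L M z = 3) ∨
    (L ≤ (π.symm z : ℕ) ∧ M ≤ (z : ℕ) ∧ centerArm π L M z = 0) := by
  unfold centerArm
  split_ifs <;> omega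

theorem centerKey_cases (π : Equiv.Perm (Fin n)) (L M i : ℕ) (z : Fin n) :
    (i % 2 = 1 ∧ (π.symm z : ℕ) < L ∧ centerKey π L M i z = π.symm z) ∨
    (i % 2 = 1 ∧ L ≤ (π.symm z : ℕ) ∧ centerKey π L M i z = n - π.symm z) ∨
    (i % 2 = 0 ∧ (z : ℕ) < M ∧ centerKey π L M i z = z) ∨
    (i % 2 = 0 ∧ M ≤ (z : ℕ) ∧ centerKey π L M i z = n - z) := by
  unfold centerKey
  split_ifs <;> omega

theorem centerKey_congr {i j : ℕ} (h : i % 2 = j % 2) : centerKey π L M i = centerKey π L M j := by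
  funext z
  rw [centerKey, centerKey, h]

theorem IsCenter.val_lt_of_pos_lt (h : IsCenter π L M) {x y : Fin n}
    (harm : centerArm π L M x = centerArm π L M y) (heven : centerArm π L M x % 2 = 0)
    (hpos : π.symm x < π.symm y) : x < y := by
  have hne : x ≠ y := fun heq => hpos.ne (by rw [heq])
  refine lt_of_not_ge fun hle => ?_
  have hdescent : IsDescent π (π.symm x) (π.symm y) := ⟨hpos, by simpa using hle.lt_of_ne hne.symm⟩
  have hleft := h.descent_left _ _ hdescent
  have hright := h.descent_right _ _ hdescent
  simp only [Equiv.apply_symm_apply] at hleft hright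
  have := centerArm_cases π L M x
  have := centerArm_cases π L M y
  omega

theorem IsCenter.val_gt_of_pos_lt (h : IsCenter π L M) {x y : Fin n}
    (harm : centerArm π L M x = centerArm π L M y) (hodd : centerArm π L M x % 2 = 1)
    (hpos : π.symm x < π.symm y) : y < x := by
  have hne : x ≠ y := fun heq => hpos.ne (by rw [heq])
  refine lt_of_not_ge fun hle => ?_
  have hascent : IsAscent π (π.symm x) (π.symm y) := ⟨hpos, by simpa using hle.lt_of_ne hne⟩
  have hleft := h.ascent_left _ _ hascent
  have hright := h.ascent_right _ _ hascent
  simp only [Equiv.apply_symm_apply] at hleft hright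
  have := centerArm_cases π L M x
  have := centerArm_cases π L M y
  omega

theorem centerArm_eq_iff {x y : Fin n} : centerArm π L M x = centerArm π L M y ↔
    (((π.symm x : ℕ) < L ↔ (π.symm y : ℕ) < L) ∧ ((x : ℕ) < M ↔ (y : ℕ) < M)) := by
  have := centerArm_cases π L M x
  have := centerArm_cases π L M y
  omega

theorem IsCenter.centerKey_succ_lt (h : IsCenter π L M) {i : ℕ} {x y : Fin n}
    (harm : centerArm π L M x = centerArm π L M y)
    (hlt : centerKey π L M i x < centerKey π L M i y) :
    centerKey π L M (i + 1) x < centerKey π L M (i + 1) y := by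
  have hpos : (π.symm x : ℕ) = π.symm y ↔ (x : ℕ) = y := by simp [← Fin.ext_iff]
  have hxy := h.val_lt_of_pos_lt harm
  have hyx := h.val_lt_of_pos_lt harm.symm
  have hxy' := h.val_gt_of_pos_lt harm
  have hyx' := h.val_gt_of_pos_lt harm.symm
  obtain ⟨hL, hM⟩ := centerArm_eq_iff.1 harm
  have hcases := centerArm_cases π L M x
  rw [← harm] at hyx hyx'
  simp only [Fin.lt_def] at hxy hyx hxy' hyx'
  simp only [centerKey, ← hL, ← hM] at hlt ⊢
  split_ifs at hlt ⊢ <;> omega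

theorem IsCenter.centerKey_succ_lt_iff (h : IsCenter π L M) {i : ℕ} {x y : Fin n}
    (harm : centerArm π L M x = centerArm π L M y) :
    centerKey π L M i x < centerKey π L M i y ↔
      centerKey π L M (i + 1) x < centerKey π L M (i + 1) y := by
  refine ⟨h.centerKey_succ_lt harm, fun hlt => ?_⟩
  rw [centerKey_congr (show i % 2 = (i + 1 + 1) % 2 by omega)]
  exact h.centerKey_succ_lt harm hlt

theorem center_acyclic_one (h3142 : ¬ Contains π p3142) {i : ℕ} (hi : i % 4 = 1) {a b c d : Fin n}
    (ha : centerArm π L M a % 4 = i % 4) (hb : centerArm π L M b % 4 = (i + 1) % 4)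
    (hc : centerArm π L M c % 4 = (i + 2) % 4) (hd : centerArm π L M d % 4 = (i + 3) % 4)
    (hab : centerKey π L M i a < centerKey π L M i b)
    (hbc : centerKey π L M (i + 1) b < centerKey π L M (i + 1) c)
    (hcd : centerKey π L M (i + 2) c < centerKey π L M (i + 2) d) :
    ¬ centerKey π L M (i + 3) d < centerKey π L M (i + 3) a := by
  intro hda
  have := centerArm_cases π L M a
  have := centerArm_cases π L M b
  have := centerArm_cases π L M c
  have := centerArm_cases π L M d
  have hab' : π.symm a < π.symm b := by
    have := centerKey_cases π L M i a
    have := centerKey_cases π L M i b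
    omega
  have hbc' : b < c := by
    have := centerKey_cases π L M (i + 1) b
    have := centerKey_cases π L M (i + 1) c
    omega
  have hcd' : π.symm d < π.symm c := by
    have := centerKey_cases π L M (i + 2) c
    have := centerKey_cases π L M (i + 2) d
    omega
  have hda' : a < d := by
    have := centerKey_cases π L M (i + 3) d
    have := centerKey_cases π L M (i + 3) a
    omega
  exact h3142 (contains_p3142 hab' (show π.symm b < π.symm d by omega) hcd' (by simpa using hbc')
    (by simpa using show c < a by omega) (by simpa using hda'))

/-- The spiralling system around a center of a permutation without `3142`. -/
def centerSystem (h : IsCenter π L M) (h3142 : ¬ Contains π p3142) : SpiralSystem (Fin n) where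
  arm := centerArm π L M
  key := centerKey π L M
  key_mod i z := by rw [centerKey_congr (show (i + 4) % 2 = i % 2 by omega)]
  key_inj i x y hx hy hxy := by
    have hpos : (π.symm x : ℕ) = π.symm y ↔ (x : ℕ) = y := by simp [← Fin.ext_iff]
    have := centerArm_cases π L M x
    have := centerArm_cases π L M y
    have := centerKey_cases π L M i x
    have := centerKey_cases π L M i y
    omega
  key_succ i x y hx hy := by
    have := centerArm_cases π L M x
    have := centerArm_cases π L M y
    exact h.centerKey_succ_lt_iff (by omega)
  acyclic := by
    let NoCycle : ℕ → Prop := fun i => ∀ a b c d, centerArm π L M a % 4 = i % 4 →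
      centerArm π L M b % 4 = (i + 1) % 4 → centerArm π L M c % 4 = (i + 2) % 4 →
      centerArm π L M d % 4 = (i + 3) % 4 → centerKey π L M i a < centerKey π L M i b →
      centerKey π L M (i + 1) b < centerKey π L M (i + 1) c →
      centerKey π L M (i + 2) c < centerKey π L M (i + 2) d →
      ¬ centerKey π L M (i + 3) d < centerKey π L M (i + 3) a
    have hone : ∀ i, i % 4 = 1 → NoCycle i := fun i hi a b c d => center_acyclic_one h3142 hi
    have hrotate : ∀ i, NoCycle (i + 1) → NoCycle i := by
      intro i hi a b c d ha hb hc hd hab hbc hcd hda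
      have hkey := centerKey_congr (π := π) (L := L) (M := M) (show i % 2 = (i + 4) % 2 by omega)
      exact hi b c d a hb hc hd (by omega) hbc hcd hda (by rwa [hkey] at hab)
    intro i
    obtain hi | hi | hi | hi : i % 4 = 1 ∨ (i + 1) % 4 = 1 ∨ (i + 2) % 4 = 1 ∨ (i + 3) % 4 = 1 := by
      omega
    exacts [hone i hi, hrotate i (hone _ hi), hrotate i (hrotate _ (hone _ hi)),
      hrotate i (hrotate _ (hrotate _ (hone _ hi)))]

end CenterSystem

section CenterSystem

variable {n : ℕ} {π : Equiv.Perm (Fin n)} {L M : ℕ} (h : IsCenter π L M)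
  (h3142 : ¬ Contains π p3142)

theorem isStep_or_isStep_of_pos {x y : Fin n} (hxy : (π.symm y : ℕ) = π.symm x + 1)
    (hy : (π.symm y : ℕ) ≠ L) :
    (centerSystem h h3142).IsStep x y ∨ (centerSystem h h3142).IsStep y x := by
  have hxarm := centerArm_cases π L M x
  have hyarm := centerArm_cases π L M y
  rcases lt_or_ge (π.symm y : ℕ) L with hleft | hright
  · have hxkey := centerKey_cases π L M 1 x
    have hykey := centerKey_cases π L M 1 y
    exact Or.inl ⟨1, by simp only [centerSystem]; omega⟩
  · have hxkey := centerKey_cases π L M 3 x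
    have hykey := centerKey_cases π L M 3 y
    exact Or.inr ⟨3, by simp only [centerSystem]; omega⟩

theorem isStep_or_isStep_of_val {x y : Fin n} (hxy : (y : ℕ) = x + 1) (hy : (y : ℕ) ≠ M) :
    (centerSystem h h3142).IsStep x y ∨ (centerSystem h h3142).IsStep y x := by
  have hxarm := centerArm_cases π L M x
  have hyarm := centerArm_cases π L M y
  rcases lt_or_ge (y : ℕ) M with hbelow | habove
  · have hxkey := centerKey_cases π L M 2 x
    have hykey := centerKey_cases π L M 2 y
    exact Or.inl ⟨2, by simp only [centerSystem]; omega⟩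
  · have hxkey := centerKey_cases π L M 0 x
    have hykey := centerKey_cases π L M 0 y
    exact Or.inr ⟨0, by simp only [centerSystem]; omega⟩

theorem isStep_or_isStep_of_permGraph_adj {x y : Fin n} (hxL : (π.symm x : ℕ) ≠ L)
    (hyL : (π.symm y : ℕ) ≠ L) (hxM : (x : ℕ) ≠ M) (hyM : (y : ℕ) ≠ M)
    (hxy : (permGraph π).Adj x y) :
    (centerSystem h h3142).IsStep x y ∨ (centerSystem h h3142).IsStep y x := by
  simp only [permGraph, Nat.dist] at hxy
  obtain (hpos | hpos) | (hval | hval) :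
      ((π.symm y : ℕ) = π.symm x + 1 ∨ (π.symm x : ℕ) = π.symm y + 1) ∨
        ((y : ℕ) = x + 1 ∨ (x : ℕ) = y + 1) := by omega
  · exact isStep_or_isStep_of_pos h h3142 hpos hyL
  · exact (isStep_or_isStep_of_pos h h3142 hpos hxL).symm
  · exact isStep_or_isStep_of_val h h3142 hval hyM
  · exact (isStep_or_isStep_of_val h h3142 hval hxM).symm

theorem card_filter_val_eq_le_one (π : Equiv.Perm (Fin n)) (a : ℕ) :
    (Finset.univ.filter fun z => (π z : ℕ) = a).card ≤ 1 :=
  Finset.card_le_one.2 fun x hx y hy => π.injective <| Fin.ext <| by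
    rw [(Finset.mem_filter.1 hx).2, (Finset.mem_filter.1 hy).2]

theorem isStripGraph_permGraph {τ : Fin n → ℕ} (hτ : (centerSystem h h3142).IsTime τ) :
    IsStripGraph (permGraph π) (centerSystem h h3142).block τ
      {z | (centerSystem h h3142).IsChain z}
      ((Finset.univ.filter fun z => (π.symm z : ℕ) = L) ∪
        Finset.univ.filter fun z : Fin n => (z : ℕ) = M) where
  time_injective := hτ.injective
  card_le := (Finset.card_union_le _ _).trans (Nat.add_le_add
    (card_filter_val_eq_le_one π.symm L) (card_filter_val_eq_le_one (Equiv.refl (Fin n)) M))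
  chain_injOn _ hx _ hy hxy := SpiralSystem.IsChain.eq hx hy hxy
  adj x y hx hy hxy := by
    simp only [Finset.mem_union, Finset.mem_filter, Finset.mem_univ, true_and, not_or] at hx hy
    rcases isStep_or_isStep_of_permGraph_adj h h3142 hx.1 hy.1 hx.2 hy.2 hxy with hstep | hstep
    · rcases hτ.consecutive_or_isChain hstep with ⟨t, ht⟩ | ⟨hchain, hxle, hyle⟩
      · exact Or.inl ⟨t, Or.inl ht⟩
      · exact Or.inr ⟨Or.inr hchain, hxle, hyle⟩
    · rcases hτ.consecutive_or_isChain hstep with ⟨t, ht⟩ | ⟨hchain, hyle, hxle⟩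
      · exact Or.inl ⟨t, Or.inr ht⟩
      · exact Or.inr ⟨Or.inl hchain, hxle, hyle⟩

theorem pos_lt_of_columns {x y : Fin n} {c d : ℕ} (hc : c % 2 = 1)
    (hx : centerArm π L M x % 4 = c % 4 ∨ centerArm π L M x % 4 = (c + 1) % 4)
    (hy : centerArm π L M y % 4 = d % 4 ∨ centerArm π L M y % 4 = (d + 1) % 4)
    (hxy : (c % 4 = 1 ∧ d % 4 = 3) ∨
      (c % 4 = 1 ∧ d % 4 = 1 ∧ centerKey π L M c x < centerKey π L M c y) ∨
      (c % 4 = 3 ∧ d % 4 = 3 ∧ centerKey π L M d y < centerKey π L M d x)) :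
    π.symm x < π.symm y := by
  have hxarm := centerArm_cases π L M x
  have hyarm := centerArm_cases π L M y
  have hxkey := centerKey_cases π L M c x
  have hykey := centerKey_cases π L M c y
  rw [centerKey_congr (show d % 2 = c % 2 by omega)] at hxy
  rw [Fin.lt_def]
  omega

theorem val_lt_of_rows {x y : Fin n} {c d : ℕ} (hc : c % 2 = 0)
    (hx : centerArm π L M x % 4 = c % 4 ∨ centerArm π L M x % 4 = (c + 1) % 4)
    (hy : centerArm π L M y % 4 = d % 4 ∨ centerArm π L M y % 4 = (d + 1) % 4)
    (hxy : (c % 4 = 2 ∧ d % 4 = 0) ∨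
      (c % 4 = 2 ∧ d % 4 = 2 ∧ centerKey π L M c x < centerKey π L M c y) ∨
      (c % 4 = 0 ∧ d % 4 = 0 ∧ centerKey π L M d y < centerKey π L M d x)) :
    x < y := by
  have hxarm := centerArm_cases π L M x
  have hyarm := centerArm_cases π L M y
  have hxkey := centerKey_cases π L M c x
  have hykey := centerKey_cases π L M c y
  rw [centerKey_congr (show d % 2 = c % 2 by omega)] at hxy
  rw [Fin.lt_def]
  omega

end CenterSystem

/-! ### Spirals from tracks -/

theorem contains_ofPoints {n N : ℕ} {α : Type*} [LinearOrder α] {π : Equiv.Perm (Fin n)}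
    {x y : Fin N → α} (hx : Function.Injective x) (hy : Function.Injective y) (p : Fin N → Fin n)
    (hpx : ∀ e e', x e < x e' → π.symm (p e) < π.symm (p e'))
    (hpy : ∀ e e', y e < y e' → p e < p e') : Contains π (ofPoints x y) := by
  refine contains_of_strictMono (f := fun a => π.symm (p (Tuple.sort x a))) ?_ ?_
  · intro a b hab
    exact hpx _ _ ((sort_symm_lt_iff hx _ _).1 (by simpa using hab))
  · intro a b hab
    simp only [Equiv.apply_symm_apply]
    exact hpy _ _ ((sort_symm_lt_iff hy _ _).1 (by simpa [ofPoints] using hab))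

theorem contains_revComp_ofPoints {n N : ℕ} {α : Type*} [LinearOrder α] {π : Equiv.Perm (Fin n)}
    {x y : Fin N → α} (hx : Function.Injective x) (hy : Function.Injective y) (p : Fin N → Fin n)
    (hpx : ∀ e e', x e < x e' → π.symm (p e') < π.symm (p e))
    (hpy : ∀ e e', y e < y e' → p e' < p e) : Contains π (revComp (ofPoints x y)) := by
  refine contains_of_strictMono (f := fun a => π.symm (p (Tuple.sort x (Fin.rev a)))) ?_ ?_
  · intro a b hab
    exact hpx _ _ ((sort_symm_lt_iff hx _ _).1 (by simpa using hab))
  · intro a b hab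
    simp only [Equiv.apply_symm_apply]
    exact hpy _ _ ((sort_symm_lt_iff hy _ _).1 (by simpa [ofPoints, revComp] using hab))

/-- The rank, counted from `0`, of an element of the `k`-track in its block: only the last block
for odd `k` does not alternate with another one. -/
def trackRank (k : ℕ) (t : Fin (k ^ 2)) : ℕ :=
  (t : ℕ) % (2 * k) / if Odd k ∧ trackBlock k t = k then 1 else 2

theorem trackRank_cases (k : ℕ) (t : Fin (k ^ 2)) : trackRank k t < k ∧
    ∃ g, (k = 2 * g + 1 ∧ trackBlock k t = 2 * g + 1 ∧ (t : ℕ) = 2 * k * g + trackRank k t ∧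
        trackSeq k t = 2 * k * g + 1 + 2 * trackRank k t) ∨
      (2 * g + 2 ≤ k ∧ trackBlock k t = 2 * g + 1 ∧ (t : ℕ) = 2 * k * g + 2 * trackRank k t ∧
        trackSeq k t = 2 * k * g + 1 + 2 * trackRank k t) ∨
      (2 * g + 2 ≤ k ∧ trackBlock k t = 2 * g + 2 ∧ (t : ℕ) = 2 * k * g + 2 * trackRank k t + 1 ∧
        trackSeq k t = 2 * k * (g + 1) + 2 * trackRank k t) := by
  obtain ⟨g, s, ht, hs, hcases⟩ := track_cases k t
  have hmod : (t : ℕ) % (2 * k) = s := by rw [ht, Nat.mul_add_mod, Nat.mod_eq_of_lt hs]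
  have hsucc : 2 * k * (g + 1) = 2 * k * g + 2 * k := by ring
  simp only [trackRank, hmod, Nat.odd_iff]
  split_ifs with hlast <;> exact ⟨by omega, g, by omega⟩

theorem trackRank_lt_or_of_pos_lt {k : ℕ} {e e' : Fin (k ^ 2)}
    (hcolumns : (trackBlock k e + 1) / 2 = (trackBlock k e' + 1) / 2) (hlt : (e : ℕ) < e') :
    trackRank k e < trackRank k e' ∨
      trackRank k e = trackRank k e' ∧ trackBlock k e < trackBlock k e' := by
  obtain ⟨-, g, hg⟩ := trackRank_cases k e
  obtain ⟨-, g', hg'⟩ := trackRank_cases k e'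
  obtain rfl : g' = g := by omega
  omega

theorem trackRank_lt_or_of_val_lt {k : ℕ} {e e' : Fin (k ^ 2)}
    (hrows : trackBlock k e / 2 = trackBlock k e' / 2) (hlt : kTrack k e < kTrack k e') :
    trackRank k e < trackRank k e' ∨
      trackRank k e = trackRank k e' ∧ trackBlock k e < trackBlock k e' := by
  have hseq : trackSeq k e < trackSeq k e' :=
    (sort_symm_lt_iff (trackSeq_injective k) e e').1 hlt
  obtain ⟨-, g, hg⟩ := trackRank_cases k e
  obtain ⟨-, g', hg'⟩ := trackRank_cases k e'
  obtain rfl | rfl | rfl : g = g' ∨ g = g' + 1 ∨ g' = g + 1 := by omega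
  all_goals omega

theorem IsTrackGrid.lt {V : Type*} {β τ : V → ℕ} {s k : ℕ} {a : ℕ → ℕ → V}
    (h : IsTrackGrid β τ s k a) {i j i' j' : ℕ} (hi : i < k) (hi' : i' < k) (hj' : j' < k)
    (hii' : i ≤ i' + 1) (hii'' : i' ≤ i + 1) (hlt : j < j' ∨ j = j' ∧ i < i') :
    τ (a i j) < τ (a i' j') := by
  have hmono : ∀ i < k, ∀ j j', j ≤ j' → j' < k → τ (a i j) ≤ τ (a i j') := by
    intro i hi j j' hjj
    induction j', hjj using Nat.le_induction with
    | base => exact fun _ => le_rfl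
    | succ l _ ih => exact fun hl => (ih (by omega)).trans (h.same i l hi hl).le
  obtain rfl | rfl | rfl : i' = i + 1 ∨ i' = i ∨ i = i' + 1 := by omega
  · exact (hmono i hi j j' (by omega) hj').trans_lt (h.right i j' hi' hj')
  · exact (h.same i' j hi (by omega)).trans_le (hmono i' hi (j + 1) j' (by omega) hj')
  · exact (h.up i' j hi (by omega)).trans_le (hmono i' hi' (j + 1) j' (by omega) hj')

/-- The point of a track grid `a` that represents the element `e` of the `k`-track. -/
def trackPoint {V : Type*} (k : ℕ) (a : ℕ → ℕ → V) (e : Fin (k ^ 2)) : V :=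
  a (trackBlock k e - 1) (trackRank k e)

theorem block_trackPoint {V : Type*} {β τ : V → ℕ} {k s : ℕ} {a : ℕ → ℕ → V}
    (ha : IsTrackGrid β τ (s + 1) k a) (e : Fin (k ^ 2)) :
    β (trackPoint k a e) = s + trackBlock k e := by
  have hrange := (isStairDecomp_trackBlock k).range e
  rw [trackPoint, ha.block _ (by omega) _ (trackRank_cases k e).1]
  omega

section SpiralSystem

variable {V : Type*} [Finite V] {Y : SpiralSystem V} {τ : V → ℕ} {k s : ℕ} {a : ℕ → ℕ → V}

theorem key_trackPoint_lt (hτ : Y.IsTime τ) (ha : IsTrackGrid Y.block τ (s + 1) k a)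
    {e e' : Fin (k ^ 2)} {c d : ℕ} (hcd : c % 4 = d % 4)
    (hc : InStrip (trackBlock k) c e) (hd : InStrip (trackBlock k) d e')
    (hlt : c < d ∨ c = d ∧ (trackRank k e < trackRank k e' ∨
      trackRank k e = trackRank k e' ∧ trackBlock k e < trackBlock k e')) :
    Y.key (s + c) (trackPoint k a e) < Y.key (s + c) (trackPoint k a e') := by
  have hblock := block_trackPoint ha e
  have hblock' := block_trackPoint ha e'
  rcases hlt with hlt | ⟨rfl, hlt⟩
  · exact Y.key_lt_of_strip_lt (q := s + d) (by omega) (by omega) (by omega) (by omega)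
  · have hrange := (isStairDecomp_trackBlock k).range e
    have hrange' := (isStairDecomp_trackBlock k).range e'
    refine (hτ.key_lt_iff (by omega) (by omega)).2 (ha.lt (by omega) (by omega)
      (trackRank_cases k e').1 (by omega) (by omega) (by omega))

theorem key_trackPoint_lt_of_columns (hτ : Y.IsTime τ) (ha : IsTrackGrid Y.block τ (s + 1) k a)
    {e e' : Fin (k ^ 2)} (hpar : (trackBlock k e + 1) / 2 % 2 = (trackBlock k e' + 1) / 2 % 2)
    (hlt : (trackBlock k e + 1) / 2 < (trackBlock k e' + 1) / 2 ∨
      (trackBlock k e + 1) / 2 = (trackBlock k e' + 1) / 2 ∧ (e : ℕ) < e') :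
    Y.key (s + (2 * ((trackBlock k e + 1) / 2) - 1)) (trackPoint k a e) <
      Y.key (s + (2 * ((trackBlock k e + 1) / 2) - 1)) (trackPoint k a e') := by
  have hrange := (isStairDecomp_trackBlock k).range e
  have hrange' := (isStairDecomp_trackBlock k).range e'
  refine key_trackPoint_lt hτ ha (d := 2 * ((trackBlock k e' + 1) / 2) - 1) (by omega) (by omega)
    (by omega) (hlt.imp (fun hlt => by omega) fun ⟨heq, hlt⟩ => ⟨by omega, ?_⟩)
  exact trackRank_lt_or_of_pos_lt heq hlt

theorem key_trackPoint_lt_of_rows (hτ : Y.IsTime τ) (ha : IsTrackGrid Y.block τ (s + 1) k a)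
    {e e' : Fin (k ^ 2)} (hpar : trackBlock k e / 2 % 2 = trackBlock k e' / 2 % 2)
    (hlt : trackBlock k e / 2 < trackBlock k e' / 2 ∨
      trackBlock k e / 2 = trackBlock k e' / 2 ∧ (kTrack k e : ℕ) < kTrack k e') :
    Y.key (s + 2 * (trackBlock k e / 2)) (trackPoint k a e) <
      Y.key (s + 2 * (trackBlock k e / 2)) (trackPoint k a e') := by
  refine key_trackPoint_lt hτ ha (d := 2 * (trackBlock k e' / 2)) (by omega) (by omega)
    (by omega) (hlt.imp (fun hlt => by omega) fun ⟨heq, hlt⟩ => ⟨by omega, ?_⟩)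
  exact trackRank_lt_or_of_val_lt heq hlt

end SpiralSystem

section CenterSystem

variable {n k s L M : ℕ} {π : Equiv.Perm (Fin n)} {h : IsCenter π L M}
  {h3142 : ¬ Contains π p3142} {τ : Fin n → ℕ} {a : ℕ → ℕ → Fin n}

theorem centerArm_trackPoint (ha : IsTrackGrid (centerSystem h h3142).block τ (s + 1) k a)
    (e : Fin (k ^ 2)) : centerArm π L M (trackPoint k a e) % 4 = (s + trackBlock k e) % 4 := by
  rw [← block_trackPoint ha e]
  exact (centerSystem h h3142).arm_mod_four _

theorem pos_trackPoint_lt (hτ : (centerSystem h h3142).IsTime τ)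
    (ha : IsTrackGrid (centerSystem h h3142).block τ (s + 1) k a) (hs : s % 4 = 0)
    {e e' : Fin (k ^ 2)} (hlt : twirlX (trackBlock k) e < twirlX (trackBlock k) e') :
    π.symm (trackPoint k a e) < π.symm (trackPoint k a e') := by
  have hrange := (isStairDecomp_trackBlock k).range e
  have hrange' := (isStairDecomp_trackBlock k).range e'
  have harm := centerArm_trackPoint ha e
  have harm' := centerArm_trackPoint ha e'
  rw [twirlX_lt_iff] at hlt
  simp only [Nat.odd_iff] at hlt
  refine pos_lt_of_columns (L := L) (M := M) (c := s + (2 * ((trackBlock k e + 1) / 2) - 1))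
    (d := s + (2 * ((trackBlock k e' + 1) / 2) - 1)) (by omega) (by omega) (by omega) ?_
  rcases hlt with ⟨hmod, hmod'⟩ | ⟨hmod, hmod', hlt⟩ | ⟨hmod, hmod', hlt⟩
  · exact Or.inl (by omega)
  · exact Or.inr (Or.inl ⟨by omega, by omega,
      key_trackPoint_lt_of_columns hτ ha (by omega) (by omega)⟩)
  · exact Or.inr (Or.inr ⟨by omega, by omega,
      key_trackPoint_lt_of_columns hτ ha (by omega) (by omega)⟩)

theorem pos_trackPoint_gt (hτ : (centerSystem h h3142).IsTime τ)
    (ha : IsTrackGrid (centerSystem h h3142).block τ (s + 1) k a) (hs : s % 4 = 2)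
    {e e' : Fin (k ^ 2)} (hlt : twirlX (trackBlock k) e < twirlX (trackBlock k) e') :
    π.symm (trackPoint k a e') < π.symm (trackPoint k a e) := by
  have hrange := (isStairDecomp_trackBlock k).range e
  have hrange' := (isStairDecomp_trackBlock k).range e'
  have harm := centerArm_trackPoint ha e
  have harm' := centerArm_trackPoint ha e'
  rw [twirlX_lt_iff] at hlt
  simp only [Nat.odd_iff] at hlt
  refine pos_lt_of_columns (L := L) (M := M) (c := s + (2 * ((trackBlock k e' + 1) / 2) - 1))
    (d := s + (2 * ((trackBlock k e + 1) / 2) - 1)) (by omega) (by omega) (by omega) ?_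
  rcases hlt with ⟨hmod, hmod'⟩ | ⟨hmod, hmod', hlt⟩ | ⟨hmod, hmod', hlt⟩
  · exact Or.inl (by omega)
  · exact Or.inr (Or.inr ⟨by omega, by omega,
      key_trackPoint_lt_of_columns hτ ha (by omega) (by omega)⟩)
  · exact Or.inr (Or.inl ⟨by omega, by omega,
      key_trackPoint_lt_of_columns hτ ha (by omega) (by omega)⟩)

theorem val_trackPoint_lt (hτ : (centerSystem h h3142).IsTime τ)
    (ha : IsTrackGrid (centerSystem h h3142).block τ (s + 1) k a) (hs : s % 4 = 0)
    {e e' : Fin (k ^ 2)}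
    (hlt : twirlY (kTrack k) (trackBlock k) e < twirlY (kTrack k) (trackBlock k) e') :
    trackPoint k a e < trackPoint k a e' := by
  have hrange := (isStairDecomp_trackBlock k).range e
  have hrange' := (isStairDecomp_trackBlock k).range e'
  have harm := centerArm_trackPoint ha e
  have harm' := centerArm_trackPoint ha e'
  rw [twirlY_lt_iff] at hlt
  simp only [Nat.odd_iff] at hlt
  refine val_lt_of_rows (π := π) (L := L) (M := M) (c := s + 2 * (trackBlock k e / 2))
    (d := s + 2 * (trackBlock k e' / 2)) (by omega) (by omega) (by omega) ?_
  rcases hlt with ⟨hmod, hmod'⟩ | ⟨hmod, hmod', hlt⟩ | ⟨hmod, hmod', hlt⟩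
  · exact Or.inl (by omega)
  · exact Or.inr (Or.inl ⟨by omega, by omega,
      key_trackPoint_lt_of_rows hτ ha (by omega) (by omega)⟩)
  · exact Or.inr (Or.inr ⟨by omega, by omega,
      key_trackPoint_lt_of_rows hτ ha (by omega) (by omega)⟩)

theorem val_trackPoint_gt (hτ : (centerSystem h h3142).IsTime τ)
    (ha : IsTrackGrid (centerSystem h h3142).block τ (s + 1) k a) (hs : s % 4 = 2)
    {e e' : Fin (k ^ 2)}
    (hlt : twirlY (kTrack k) (trackBlock k) e < twirlY (kTrack k) (trackBlock k) e') :
    trackPoint k a e' < trackPoint k a e := by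
  have hrange := (isStairDecomp_trackBlock k).range e
  have hrange' := (isStairDecomp_trackBlock k).range e'
  have harm := centerArm_trackPoint ha e
  have harm' := centerArm_trackPoint ha e'
  rw [twirlY_lt_iff] at hlt
  simp only [Nat.odd_iff] at hlt
  refine val_lt_of_rows (π := π) (L := L) (M := M) (c := s + 2 * (trackBlock k e' / 2))
    (d := s + 2 * (trackBlock k e / 2)) (by omega) (by omega) (by omega) ?_
  rcases hlt with ⟨hmod, hmod'⟩ | ⟨hmod, hmod', hlt⟩ | ⟨hmod, hmod', hlt⟩
  · exact Or.inl (by omega)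
  · exact Or.inr (Or.inr ⟨by omega, by omega,
      key_trackPoint_lt_of_rows hτ ha (by omega) (by omega)⟩)
  · exact Or.inr (Or.inl ⟨by omega, by omega,
      key_trackPoint_lt_of_rows hτ ha (by omega) (by omega)⟩)

theorem contains_kSpiral_of_isTrackGrid (hτ : (centerSystem h h3142).IsTime τ)
    (ha : IsTrackGrid (centerSystem h h3142).block τ (s + 1) k a) (hs : Even s) :
    Contains π (kSpiral k) ∨ Contains π (revComp (kSpiral k)) := by
  obtain hs | hs : s % 4 = 0 ∨ s % 4 = 2 := by rw [Nat.even_iff] at hs; omega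
  · exact Or.inl (contains_ofPoints (twirlX_injective _) (twirlY_injective _ _) (trackPoint k a)
      (fun _ _ => pos_trackPoint_lt hτ ha hs) fun _ _ => val_trackPoint_lt hτ ha hs)
  · exact Or.inr (contains_revComp_ofPoints (twirlX_injective _) (twirlY_injective _ _)
      (trackPoint k a) (fun _ _ => pos_trackPoint_gt hτ ha hs)
      fun _ _ => val_trackPoint_gt hτ ha hs)

end CenterSystem

theorem contains_of_size_zero {n k : ℕ} (hk : k = 0) (π : Equiv.Perm (Fin n))
    (σ : Equiv.Perm (Fin k)) : Contains π σ := by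
  subst hk
  exact ⟨Fin.elim0, fun i => i.elim0, fun i => i.elim0⟩

theorem le_mul_rpow_of_one_le {c e : ℝ} (hc : 0 ≤ c) (he : 1 ≤ e) (k : ℕ) :
    c * k ≤ c * (k : ℝ) ^ e := by
  rcases k.eq_zero_or_pos with rfl | hk
  · simpa using mul_nonneg hc (Real.rpow_nonneg le_rfl e)
  · exact mul_le_mul_of_nonneg_left (Real.self_le_rpow_of_one_le (Nat.one_le_cast.2 hk) he) hc

end PermPattern

theorem mainTheorem8_general (n k r : ℕ) (π : Equiv.Perm (Fin n))
    (hπ : π ∈ PermPattern.Av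
      {⟨4, PermPattern.p2143⟩, ⟨4, PermPattern.p3412⟩, ⟨4, PermPattern.p3142⟩} n)
    (hr : 132 * k ≤ r) (hwall : PermPattern.ContainsWall (PermPattern.permGraph π) r) :
    PermPattern.Contains π (PermPattern.kSpiral k) ∨
      PermPattern.Contains π (PermPattern.revComp (PermPattern.kSpiral k)) := by
  open PermPattern in
  rcases k.eq_zero_or_pos with rfl | hk
  · exact Or.inl (contains_of_size_zero rfl π _)
  have h2143 : ¬ Contains π p2143 := hπ ⟨4, p2143⟩ (by simp)
  have h3412 : ¬ Contains π p3412 := hπ ⟨4, p3412⟩ (by simp)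
  have h3142 : ¬ Contains π p3142 := hπ ⟨4, p3142⟩ (by simp)
  obtain ⟨L, M, hcenter⟩ := exists_isCenter h2143 h3412
  obtain ⟨τ, hτ⟩ := (centerSystem hcenter h3142).exists_isTime
  obtain ⟨R, C, hmesh⟩ := exists_isMesh_of_containsWall hwall
  obtain ⟨s, hs, hwave⟩ :=
    (isStripGraph_permGraph hcenter h3142 hτ).exists_wave_nonempty hmesh (k := k) (by omega)
  obtain ⟨a, ha⟩ := exists_isTrackGrid (s := s + 1) hk fun i h1 h2 => hwave i (by omega) (by omega)
  exact contains_kSpiral_of_isTrackGrid hτ ha hs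

theorem mainTheorem8 (n k r : ℕ) (π : Equiv.Perm (Fin n))
    (hπ : π ∈ PermPattern.Av
      {⟨4, PermPattern.p2143⟩, ⟨4, PermPattern.p3412⟩, ⟨4, PermPattern.p3142⟩} n)
    (hr_even : Even r) (hr_two : 2 ≤ r)
    (hr : 300 * (k : ℝ) ^ (3 / 2 : ℝ) ≤ (r : ℝ))
    (hwall : PermPattern.ContainsWall (PermPattern.permGraph π) r) :
    PermPattern.Contains π (PermPattern.kSpiral k) ∨
      PermPattern.Contains π (PermPattern.revComp (PermPattern.kSpiral k)) := by
  have hlinear : (300 : ℝ) * k ≤ r :=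
    (PermPattern.le_mul_rpow_of_one_le (by norm_num) (by norm_num) k).trans hr
  exact mainTheorem8_general n k r π hπ (by norm_cast at hlinear; omega) hwall
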